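/- Let $H_k$ be the Iwahori--Hecke algebra over $\mathbb{C}(a)$ with generators $g_1,\dots,g_{k-1}$ and relations $g_ig_{i+1}g_i=g_{i+1}g_ig_{i+1}$, $g_ig_j=g_jg_i$ for $|i-j|\ge 2$, and $g_i^2=(a-a^{-1})g_i+1$. Let $\mathcal{H}$ be the idempotent completion of the monoidal category whose objects are the natural numbers, with $\mathrm{End}(k)=H_k$, no nonzero morphisms between different objects, and tensor product $H_m\otimes H_n\to H_{m+n}$, $g_i\otimes g_j\mapsto g_ig_{m+j}$. Its simple objects are indexed by partitions (a single row of $k$ boxes corresponds to the trivial representation $g_i\mapsto a$ of $H_k$); write $\square$ for the object $1$, so that $\mathrm{End}(\square^{\otimes n})=H_n$. For objects $X,Y$ write $\mathcal{H}(X,Y)$ for the space of morphisms $X\to Y$. The algebra $H_n$ acts on $\mathcal{H}(\mu,\lambda\otimes\square^{\otimes n})$ by composition with $1_\lambda\otimes h$, and a vector $v$ is called invariant if $g_iv=av$ for $1\le i\le n-1$. Let $\lambda\subseteq\mu$ be partitions and let $n=|\mu|-|\lambda|$. Then $\mathcal{H}(\mu,\lambda\otimes\square^{\otimes n})$ contains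 a nonzero invariant vector if and only if $\mu\setminus\lambda$ is a horizontal strip, that is, has at most one box in each column. Suppose that $\mu\setminus\lambda$ is a horizontal strip. Then the space of invariants is one-dimensional, and there is a unique $H_n$-equivariant linear projection $\pi$ of $\mathcal{H}(\mu,\lambda\otimes\square^{\otimes n})$ onto it. Let $P$ be a standard skew tableau of shape $\mu\setminus\lambda$, and let $\lambda=\nu_0\subset\nu_1\subset\dots\subset\nu_n=\mu$ be the corresponding path in Young's graph, where $\nu_i$ consists of $\lambda$ and the boxes of $P$ with entries at most $i$. For any nonzero morphisms $x_i\in\mathcal{H}(\nu_i,\nu_{i-1}\otimes\square)$, $1\le i\le n$, let $v_P\in\mathcal{H}(\mu,\lambda\otimes\square^{\otimes n})$ be the composite $\mu=\nu_n\to\nu_{n-1}\otimes\square\to\dots\to\lambda\otimes\square^{\otimes n}$ (the identity of $\lambda$ if $n=0$). Then $\pi(v_P)\ne 0$. -/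

import Mathlib

namespace SkewHecke

noncomputable section

/-! ## The Iwahori-Hecke algebras -/

/-- The ground field `ℂ(a)`. -/
abbrev K : Type := RatFunc ℂ

/-- The parameter `a` of the ground field `ℂ(a)`. -/
def a : K := RatFunc.X

/-- Defining relations of `H_n`; the index `i : Fin (n - 1)` stands for the generator `g_{i+1}`. -/
inductive Rel (n : ℕ) : FreeAlgebra K (Fin (n - 1)) → FreeAlgebra K (Fin (n - 1)) → Prop
  | braid (i j : Fin (n - 1)) (h : i.1 + 1 = j.1) :
      Rel n (FreeAlgebra.ι K i * FreeAlgebra.ι K j * FreeAlgebra.ι K i)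
        (FreeAlgebra.ι K j * FreeAlgebra.ι K i * FreeAlgebra.ι K j)
  | comm (i j : Fin (n - 1)) (h : i.1 + 2 ≤ j.1) :
      Rel n (FreeAlgebra.ι K i * FreeAlgebra.ι K j) (FreeAlgebra.ι K j * FreeAlgebra.ι K i)
  | quad (i : Fin (n - 1)) :
      Rel n (FreeAlgebra.ι K i * FreeAlgebra.ι K i) ((a - a⁻¹) • FreeAlgebra.ι K i + 1)

/-- The Iwahori-Hecke algebra `H_n` over `ℂ(a)`, with generators `g_1, …, g_{n-1}`. -/
abbrev Hecke (n : ℕ) : Type := RingQuot (Rel n)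

/-- The generator `g_{i+1}` of `H_n`. -/
def gen {n : ℕ} (i : Fin (n - 1)) : Hecke n :=
  RingQuot.mkAlgHom K (Rel n) (FreeAlgebra.ι K i)

theorem gen_braid {n : ℕ} (i j : Fin (n - 1)) (h : i.1 + 1 = j.1) :
    gen i * gen j * gen i = gen j * gen i * gen j := by
  have := RingQuot.mkAlgHom_rel K (Rel.braid i j h)
  simpa only [gen, map_mul] using this

theorem gen_comm {n : ℕ} (i j : Fin (n - 1)) (h : i.1 + 2 ≤ j.1) :
    gen i * gen j = gen j * gen i := by
  have := RingQuot.mkAlgHom_rel K (Rel.comm i j h)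
  simpa only [gen, map_mul] using this

theorem gen_quad {n : ℕ} (i : Fin (n - 1)) :
    gen i * gen i = (a - a⁻¹) • gen i + 1 := by
  have := RingQuot.mkAlgHom_rel K (Rel.quad i)
  simpa only [gen, map_mul, map_add, map_smul, map_one] using this

/-- The universal property of `H_n`. -/
def lift {n : ℕ} {A : Type} [Ring A] [Algebra K A] (f : Fin (n - 1) → A)
    (hb : ∀ i j : Fin (n - 1), i.1 + 1 = j.1 → f i * f j * f i = f j * f i * f j)
    (hc : ∀ i j : Fin (n - 1), i.1 + 2 ≤ j.1 → f i * f j = f j * f i)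
    (hq : ∀ i : Fin (n - 1), f i * f i = (a - a⁻¹) • f i + 1) : Hecke n →ₐ[K] A :=
  RingQuot.liftAlgHom K ⟨FreeAlgebra.lift K f, by
    intro x y h
    cases h with
    | braid i j h => simpa using hb i j h
    | comm i j h => simpa using hc i j h
    | quad i => simpa using hq i⟩

theorem lift_gen {n : ℕ} {A : Type} [Ring A] [Algebra K A] (f : Fin (n - 1) → A)
    (hb : ∀ i j : Fin (n - 1), i.1 + 1 = j.1 → f i * f j * f i = f j * f i * f j)
    (hc : ∀ i j : Fin (n - 1), i.1 + 2 ≤ j.1 → f i * f j = f j * f i)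
    (hq : ∀ i : Fin (n - 1), f i * f i = (a - a⁻¹) • f i + 1) (i : Fin (n - 1)) :
    lift f hb hc hq (gen i) = f i := by
  simp [lift, gen]

/-- The embedding `H_m → H_{m+n}`, `h ↦ h ⊗ 1`, given by `g_i ↦ g_i`. -/
def inl (m n : ℕ) : Hecke m →ₐ[K] Hecke (m + n) :=
  lift (fun i => gen ⟨i.1, by omega⟩)
    (fun _ _ h => gen_braid _ _ h) (fun _ _ h => gen_comm _ _ h) (fun _ => gen_quad _)

/-- The embedding `H_n → H_{m+n}`, `h ↦ 1 ⊗ h`, given by `g_j ↦ g_{m+j}`. -/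
def inr (m n : ℕ) : Hecke n →ₐ[K] Hecke (m + n) :=
  lift (fun j => gen ⟨m + j.1, by omega⟩)
    (fun _ _ h => gen_braid _ _ (by simp only; omega))
    (fun _ _ h => gen_comm _ _ (by simp only; omega)) (fun _ => gen_quad _)

theorem hecke_induction {n : ℕ} {p : Hecke n → Prop} (hg : ∀ i, p (gen i))
    (hs : ∀ r : K, p (algebraMap K _ r)) (hm : ∀ x y, p x → p y → p (x * y))
    (ha : ∀ x y, p x → p y → p (x + y)) (x : Hecke n) : p x := by
  obtain ⟨y, rfl⟩ := RingQuot.mkAlgHom_surjective K (Rel n) x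
  induction y using FreeAlgebra.induction with
  | grade0 r => simpa using hs r
  | grade1 i => exact hg i
  | mul x y hx hy => simpa using hm _ _ hx hy
  | add x y hx hy => simpa using ha _ _ hx hy

/-- The two tensor factors commute in `H_{m+n}`. -/
theorem inl_inr_commute {m n : ℕ} (x : Hecke m) (y : Hecke n) :
    Commute (inl m n x) (inr m n y) := by
  induction x using hecke_induction with
  | hg i =>
    induction y using hecke_induction with
    | hg j =>
      simp only [inl, inr, lift_gen]
      exact gen_comm _ _ (by simp only; omega)
    | hs r => rw [AlgHom.commutes]; exact (Algebra.commutes r _).symm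
    | hm x y hx hy => rw [map_mul]; exact hx.mul_right hy
    | ha x y hx hy => rw [map_add]; exact hx.add_right hy
  | hs r => rw [AlgHom.commutes]; exact Algebra.commutes r _
  | hm x y hx hy => rw [map_mul]; exact hx.mul_left hy
  | ha x y hx hy => rw [map_add]; exact hx.add_left hy

theorem a_ne_zero : a ≠ 0 := RatFunc.X_ne_zero

/-- The trivial representation `H_n → ℂ(a)`, `g_i ↦ a`: the one labelled by a single row. -/
def triv (n : ℕ) : Hecke n →ₐ[K] K :=
  lift (fun _ => a) (fun _ _ _ => rfl) (fun _ _ _ => rfl) (fun _ => by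
    have := a_ne_zero
    simp only [smul_eq_mul]
    field_simp
    ring)

/-! ## The idempotent completion

An object of degree `k` is an idempotent `e ∈ H_k`. There are no nonzero morphisms between objects
of different degrees. -/

/-- The morphisms `e → f` in the idempotent completion: the space `f H_k e`. Composition is
multiplication in `H_k`. -/
def Hom {k : ℕ} (e f : Hecke k) : Submodule K (Hecke k) where
  carrier := {x | f * x = x ∧ x * e = x}
  add_mem' := by
    rintro x y ⟨h1, h2⟩ ⟨h3, h4⟩
    exact ⟨by rw [mul_add, h1, h3], by rw [add_mul, h2, h4]⟩
  zero_mem' := by simp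
  smul_mem' := by
    rintro c x ⟨h1, h2⟩
    exact ⟨by rw [mul_smul_comm, h1], by rw [smul_mul_assoc, h2]⟩

/-- The tensor product of objects, `(m, e) ⊗ (n, f) = (m + n, e ⊗ f)`. -/
def tensor {m n : ℕ} (e : Hecke m) (f : Hecke n) : Hecke (m + n) := inl m n e * inr m n f

/-- The object `□^{⊗ n}`, that is, the object `n` of the category of Hecke algebras. -/
def boxPow (n : ℕ) : Hecke n := 1

theorem tensor_boxPow (m n : ℕ) : tensor (boxPow m) (boxPow n) = boxPow (m + n) := by
  simp [tensor, boxPow]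

/-! ## Partitions and standard tableaux -/

/-- Partitions of `k`, as Young diagrams; the cell `(i, j)` lies in row `i` and column `j`. -/
abbrev Ptn (k : ℕ) : Type := {ν : YoungDiagram // ν.card = k}

/-- `μ \ λ` is a horizontal strip: it has at most one box in each column. -/
def HorizontalStrip (lam mu : YoungDiagram) : Prop :=
  lam ≤ mu ∧ ∀ c ∈ mu.cells \ lam.cells, ∀ d ∈ mu.cells \ lam.cells, c.2 = d.2 → c = d

/-- Standard tableaux of skew shape `μ \ λ`, where `n` is the number of boxes. The box with entry
`i + 1` is `pos i`; entries increase along rows and columns. -/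
structure StdTab (lam mu : YoungDiagram) (n : ℕ) where
  pos : Fin n ≃ {c // c ∈ mu.cells \ lam.cells}
  increasing : ∀ i j : Fin n, (pos i).1 ≤ (pos j).1 → i ≤ j

/-- The content (column minus row) of the box with entry `i + 1`. -/
def StdTab.content {lam mu : YoungDiagram} {n : ℕ} (T : StdTab lam mu n) (i : Fin n) : ℤ :=
  ((T.pos i).1.2 : ℤ) - ((T.pos i).1.1 : ℤ)

theorem StdTab.exists_of_card {lam mu : YoungDiagram} {n : ℕ}
    (h : (mu.cells \ lam.cells).card = n) : Nonempty (StdTab lam mu n) := by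
  let s : Finset (ℕ ×ₗ ℕ) := (mu.cells \ lam.cells).map toLex.toEmbedding
  have hs : s.card = n := by simpa [s] using h
  let o := s.orderIsoOfFin hs
  have hmem : ∀ c : ℕ ×ₗ ℕ, c ∈ s ↔ ofLex c ∈ mu.cells \ lam.cells := by
    intro c
    simp only [s, Finset.mem_map_equiv]
    rfl
  let q : {c // c ∈ s} ≃ {c // c ∈ mu.cells \ lam.cells} := ofLex.subtypeEquiv hmem
  refine ⟨⟨o.toEquiv.trans q, ?_⟩⟩
  intro i j hij
  have h2 : (toLex (ofLex (o i).1)) ≤ toLex (ofLex (o j).1) := Prod.Lex.toLex_mono hij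
  exact o.le_iff_le.mp h2

/-- The shape formed by `λ` and the boxes of `T` with entries at most `i`. -/
def StdTab.shape {lam mu : YoungDiagram} {n : ℕ} (T : StdTab lam mu n) (_h : lam ≤ mu) (i : ℕ) :
    YoungDiagram where
  cells := lam.cells ∪ (Finset.univ.filter fun j : Fin n => j.1 < i).image fun j => (T.pos j).1
  isLowerSet := by
    intro c d hdc hc
    simp only [Finset.coe_union, Set.mem_union, Finset.mem_coe, Finset.mem_image,
      Finset.mem_filter, Finset.mem_univ, true_and] at hc ⊢
    rcases hc with hc | ⟨j, hj, rfl⟩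
    · exact Or.inl (lam.isLowerSet hdc hc)
    · by_cases hd : d ∈ lam.cells
      · exact Or.inl hd
      · have hmu : d ∈ mu.cells :=
          mu.isLowerSet hdc (Finset.mem_sdiff.mp (T.pos j).2).1
        refine Or.inr ⟨T.pos.symm ⟨d, Finset.mem_sdiff.mpr ⟨hmu, hd⟩⟩, ?_, by simp⟩
        have := T.increasing (T.pos.symm ⟨d, Finset.mem_sdiff.mpr ⟨hmu, hd⟩⟩) j (by simpa using hdc)
        exact lt_of_le_of_lt this hj

theorem StdTab.card_shape {lam mu : YoungDiagram} {n : ℕ} (T : StdTab lam mu n) (h : lam ≤ mu)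
    {i : ℕ} (hi : i ≤ n) : (T.shape h i).card = lam.card + i := by
  have hdis : Disjoint lam.cells
      ((Finset.univ.filter fun j : Fin n => j.1 < i).image fun j => (T.pos j).1) := by
    rw [Finset.disjoint_right]
    intro c hc
    obtain ⟨j, -, rfl⟩ := Finset.mem_image.mp hc
    exact (Finset.mem_sdiff.mp (T.pos j).2).2
  have hinj : Function.Injective fun j : Fin n => (T.pos j).1 :=
    Subtype.val_injective.comp T.pos.injective
  simp only [YoungDiagram.card, shape, Finset.card_union_of_disjoint hdis,
    Finset.card_image_of_injective _ hinj]
  congr 1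
  rw [Fin.card_filter_val_lt]
  omega

/-- The `i`-th vertex of the path `λ = ν_0 ⊂ ν_1 ⊂ ⋯ ⊂ ν_n = μ` in Young's graph given by a
standard skew tableau. -/
def StdTab.path {m n : ℕ} {lam : Ptn m} {mu : Ptn (m + n)} (T : StdTab lam.1 mu.1 n)
    (h : lam.1 ≤ mu.1) (i : ℕ) (hi : i ≤ n) : Ptn (m + i) :=
  ⟨T.shape h i, by rw [T.card_shape h hi, lam.2]⟩

/-! ## The simple objects -/

/-- The Jucys-Murphy elements `L_1 = 1`, `L_{i+1} = g_i L_i g_i` of `H_k`; `jucysMurphy k i` is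
`L_{i+1}`, for `i < k`. -/
def jucysMurphy (k : ℕ) : ℕ → Hecke k
  | 0 => 1
  | i + 1 => if h : i < k - 1 then gen ⟨i, h⟩ * jucysMurphy k i * gen ⟨i, h⟩ else 0

/-- The primitive idempotent of `H_k` attached to a standard tableau `T` of shape `ν`. In the
irreducible representation labelled by a partition, with its semi-normal basis `(v_S)` indexed by
standard tableaux, `L_i v_S = a^{2 c} v_S` where `c` is the content of the box of `S` with entry
`i`, so `|c| < i`. The element below is the product of the Lagrange interpolation polynomials
in the `L_i`: it is the projection to the line spanned by `v_T`, and is zero in all other irreducible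
representations. As an object of the idempotent completion it is the simple object `ν`. -/
def simpleIdem {nu : YoungDiagram} {k : ℕ} (T : StdTab ⊥ nu k) : Hecke k :=
  (List.ofFn fun i : Fin k =>
    Polynomial.aeval (jucysMurphy k i)
      (Lagrange.basis (Finset.Icc (-(i.1 : ℤ)) (i.1 : ℤ)) (fun c : ℤ => a ^ (2 * c))
        (T.content i))).prod

/-- A choice of a simple object in each isomorphism class: tableaux of the same shape have isomorphic
objects. -/
abbrev Choice : Type := ∀ (k : ℕ) (nu : Ptn k), StdTab ⊥ nu.1 k

theorem nonempty_choice : Nonempty Choice :=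
  ⟨fun _ nu => (StdTab.exists_of_card (by simpa [YoungDiagram.card] using nu.2)).some⟩

/-- The simple object of degree `k` labelled by the partition `ν` of `k`. -/
def simple (t : Choice) {k : ℕ} (nu : Ptn k) : Hecke k := simpleIdem (t k nu)

/-! ## The skew representations -/

/-- The multiplicity space `ℋ(μ, λ ⊗ □^{⊗ n})`. -/
abbrev SkewRep (t : Choice) {m n : ℕ} (lam : Ptn m) (mu : Ptn (m + n)) :
    Submodule K (Hecke (m + n)) :=
  Hom (simple t mu) (tensor (simple t lam) (boxPow n))

theorem inr_mul_mem (t : Choice) {m n : ℕ} (lam : Ptn m) (mu : Ptn (m + n)) (h : Hecke n)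
    {x : Hecke (m + n)} (hx : x ∈ SkewRep t lam mu) : inr m n h * x ∈ SkewRep t lam mu := by
  obtain ⟨h1, h2⟩ := hx
  simp only [tensor, boxPow, map_one, mul_one] at h1
  refine ⟨?_, by rw [mul_assoc, h2]⟩
  simp only [tensor, boxPow, map_one, mul_one]
  rw [← mul_assoc, (inl_inr_commute _ _).eq, mul_assoc, h1]

/-- The action of `H_n = End(□^{⊗ n})` on `ℋ(μ, λ ⊗ □^{⊗ n})` by composition with `1 ⊗ h`. -/
def action (t : Choice) {m n : ℕ} (lam : Ptn m) (mu : Ptn (m + n)) :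
    Hecke n →ₐ[K] Module.End K (SkewRep t lam mu) :=
  AlgHom.ofLinearMap
    { toFun := fun h =>
        { toFun := fun x => ⟨inr m n h * x.1, inr_mul_mem t lam mu h x.2⟩
          map_add' := fun x y => Subtype.ext (mul_add _ _ _)
          map_smul' := fun c x => Subtype.ext (mul_smul_comm _ _ _) }
      map_add' := fun h h' => by ext x; simp [add_mul]
      map_smul' := fun c h => by ext x; simp }
    (by ext x; simp)
    (fun h h' => by ext x; simp [mul_assoc])

/-- The Hecke algebra invariants: the vectors on which `H_n` acts through the trivial
representation. -/
def invariants (t : Choice) {m n : ℕ} (lam : Ptn m) (mu : Ptn (m + n)) :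
    Submodule K (SkewRep t lam mu) where
  carrier := {x | ∀ h : Hecke n, action t lam mu h x = triv n h • x}
  add_mem' := fun hx hy h => by rw [map_add, hx h, hy h, smul_add]
  zero_mem' := fun h => by simp
  smul_mem' := fun c x hx h => by rw [map_smul, hx h, smul_comm]

/-- `π` is an `H_n`-equivariant linear projection of the skew representation onto its invariants. -/
def IsInvariantProjection (t : Choice) {m n : ℕ} (lam : Ptn m) (mu : Ptn (m + n))
    (π : Module.End K (SkewRep t lam mu)) : Prop :=
  LinearMap.IsProj (invariants t lam mu) π ∧
    ∀ (h : Hecke n) (x : SkewRep t lam mu), π (action t lam mu h x) = action t lam mu h (π x)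

/-- A choice of trivalent vertices along a skew tableau `P`: nonzero morphisms
`x_i : ν_{i+1} → ν_i ⊗ □` for the edges of the path `λ = ν_0 ⊂ ⋯ ⊂ ν_n = μ`. -/
def IsVertices (t : Choice) {m n : ℕ} {lam : Ptn m} {mu : Ptn (m + n)} (hle : lam.1 ≤ mu.1)
    (P : StdTab lam.1 mu.1 n) (x : ∀ i : ℕ, Hecke (m + i + 1)) : Prop :=
  ∀ (i : ℕ) (hi : i + 1 ≤ n),
    x i ∈ Hom (simple t (P.path hle (i + 1) hi))
      (tensor (m := m + i) (simple t (P.path hle i (Nat.le_of_succ_le hi))) (boxPow 1)) ∧ x i ≠ 0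

/-- The composite `ν_i → ν_{i-1} ⊗ □ → ⋯ → λ ⊗ □^{⊗ i}` of trivalent vertices, where `e` is the
object `λ`, so that the composite for `i = 0` is the identity of `λ`. -/
def treeVector {m : ℕ} (e : Hecke m) (x : ∀ i : ℕ, Hecke (m + i + 1)) :
    ∀ i : ℕ, Hecke (m + i)
  | 0 => e
  | i + 1 => tensor (treeVector e x i) (boxPow 1) * x i

end

end SkewHecke

open SkewHecke

namespace SkewHecke
noncomputable section

/-! Everything is computed in Young's semi-normal form. `H_k` acts on the space with basis `vec k
b`, for `b` a standard tableau with `k` boxes. The generator with index `i` sends this vector to `A`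
times itself plus `B` times the vector of the tableau with the entries `i`, `i + 1` exchanged. The
normalization `B = a - A` for an admissible exchange is the point of the proof: all rules then
preserve the sum of coordinates up to the factor `a`, except that vertical neighbours with
consecutive entries give `-a⁻¹`.

This representation is faithful. The matrix units lie in its image (`coefMap_surjective`), the
number of pairs of tableaux of equal shape is `k!` (`sum_numTabs_shape`), and coset representatives
give `dim H_k ≤ k!` (`hecke_finite_finrank_le`). The simple idempotents act as projections to basis
vectors (`rep_prefixIdem`). So a morphism `μ → λ ⊗ □^n` is determined by one vector, supported on
the tableaux of shape `μ` that extend the tableau chosen for `λ`.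

Invariance relates the coordinates at two tableaux that differ by an exchange, with a nonzero
factor. All relevant tableaux are connected by exchanges, so one zero coordinate kills an invariant
(`eq_zero_of_invariant`): the invariants have dimension at most one. If `μ \ λ` is not a horizontal
strip, some tableau has vertical neighbours with consecutive entries; its coordinate is zero because
`a ≠ -a⁻¹` (`invariants_eq_bot`).

If `μ \ λ` is a horizontal strip, the coordinate sum is an equivariant functional to the trivial
representation (`coordSum_inr`), and it is preserved by the symmetrizer `p` of `exists_symmetrizer`.
The projection `π` can only be the action of `p`. The tree vector of `P` is a nonzero multiple of
one basis vector (`treeVector_spec`), so its coordinate sum is nonzero, and hence so is its image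
under `π`. -/

/-! ## Tableaux as sequences of cells -/

/-- `b` lists the cells of a standard tableau with `k` boxes, padded by `0`. -/
structure IsStd (k : ℕ) (b : ℕ → ℕ × ℕ) : Prop where
  zero : ∀ i, k ≤ i → b i = 0
  inj : ∀ i j, i < k → j < k → b i = b j → i = j
  lower : ∀ i, i < k → ∀ c, c ≤ b i → ∃ j, j ≤ i ∧ b j = c

/-- The content of a cell. -/
def cont (c : ℕ × ℕ) : ℤ := (c.2 : ℤ) - (c.1 : ℤ)

/-- Exchange the entries `i` and `i + 1`. -/
def sw (i : ℕ) (b : ℕ → ℕ × ℕ) : ℕ → ℕ × ℕ := fun j =>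
  if j = i then b (i + 1) else if j = i + 1 then b i else b j

/-- The set of the first `k` cells. -/
def shape (k : ℕ) (b : ℕ → ℕ × ℕ) : Finset (ℕ × ℕ) := (Finset.range k).image b

theorem sw_left (i : ℕ) (b : ℕ → ℕ × ℕ) : sw i b i = b (i + 1) := by simp [sw]

theorem sw_right (i : ℕ) (b : ℕ → ℕ × ℕ) : sw i b (i + 1) = b i := by simp [sw]

theorem sw_of_ne {i j : ℕ} (b : ℕ → ℕ × ℕ) (h : j ≠ i) (h' : j ≠ i + 1) : sw i b j = b j := by
  simp [sw, h, h']

theorem sw_sw (i : ℕ) (b : ℕ → ℕ × ℕ) : sw i (sw i b) = b := by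
  funext j
  simp only [sw]
  split_ifs <;> first | omega | simp_all

theorem sw_braid (i : ℕ) (b : ℕ → ℕ × ℕ) :
    sw i (sw (i + 1) (sw i b)) = sw (i + 1) (sw i (sw (i + 1) b)) := by
  funext j
  simp only [sw]
  split_ifs <;> first | omega | rfl

theorem sw_comm {i j : ℕ} (h : i + 2 ≤ j) (b : ℕ → ℕ × ℕ) : sw i (sw j b) = sw j (sw i b) := by
  funext l
  simp only [sw]
  split_ifs <;> first | omega | rfl

theorem mem_shape {k : ℕ} {b : ℕ → ℕ × ℕ} {c : ℕ × ℕ} : c ∈ shape k b ↔ ∃ i < k, b i = c := by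
  simp [shape]

theorem shape_sw {k i : ℕ} (h : i + 1 < k) (b : ℕ → ℕ × ℕ) : shape k (sw i b) = shape k b := by
  have key : ∀ b : ℕ → ℕ × ℕ, shape k (sw i b) ⊆ shape k b := by
    intro b c hc
    obtain ⟨j, hj, rfl⟩ := mem_shape.1 hc
    refine mem_shape.2 ?_
    by_cases h1 : j = i
    · exact ⟨i + 1, h, by rw [h1, sw_left]⟩
    by_cases h2 : j = i + 1
    · exact ⟨i, by omega, by rw [h2, sw_right]⟩
    exact ⟨j, hj, (sw_of_ne b h1 h2).symm⟩
  refine Finset.Subset.antisymm (key b) ?_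
  have := key (sw i b)
  rwa [sw_sw] at this

namespace IsStd

variable {k : ℕ} {b : ℕ → ℕ × ℕ}

theorem le_index (hb : IsStd k b) {i j : ℕ} (hi : i < k) (hj : j < k) (h : b i ≤ b j) : i ≤ j := by
  obtain ⟨l, hl, h1⟩ := hb.lower j hj _ h
  have := hb.inj l i (by omega) hi h1
  omega

theorem isLowerSet_shape (hb : IsStd k b) : IsLowerSet (shape k b : Set (ℕ × ℕ)) := by
  intro c d hdc hc
  obtain ⟨i, hi, rfl⟩ := mem_shape.1 hc
  obtain ⟨j, hj, rfl⟩ := hb.lower i hi d hdc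
  exact mem_shape.2 ⟨j, by omega, rfl⟩

theorem card_shape (hb : IsStd k b) : (shape k b).card = k := by
  rw [shape, Finset.card_image_of_injOn, Finset.card_range]
  intro i hi j hj h
  simp only [Finset.coe_range, Set.mem_Iio] at hi hj
  exact hb.inj i j hi hj h

/-- The coordinates of the cell with index `i` are at most `i`. -/
theorem coord_le (hb : IsStd k b) {i : ℕ} (hi : i < k) : (b i).1 ≤ i ∧ (b i).2 ≤ i := by
  -- `N + 1` distinct cells below `b i` must all occur among the first `i + 1` cells. This is
  -- applied to the column above `b i` and to the row left of it.
  have key : ∀ (f : ℕ → ℕ × ℕ) (N : ℕ), Function.Injective f → (∀ r, r ≤ N → f r ≤ b i) → N ≤ i := by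
    intro f N hf hle
    have hsub : (Finset.range (N + 1)).image f ⊆ (Finset.range (i + 1)).image b := by
      intro c hc
      obtain ⟨r, hr, rfl⟩ := Finset.mem_image.1 hc
      obtain ⟨j, hj, h⟩ := hb.lower i hi _ (hle r (by simpa [Nat.lt_succ_iff] using hr))
      exact Finset.mem_image.2 ⟨j, by simpa [Nat.lt_succ_iff] using hj, h⟩
    have h1 := Finset.card_le_card hsub
    rw [Finset.card_image_of_injective _ hf, Finset.card_range] at h1
    have h2 := (Finset.card_image_le (s := Finset.range (i + 1)) (f := b))
    rw [Finset.card_range] at h2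
    omega
  constructor
  · exact key (fun r => (r, (b i).2)) _ (fun r s h => (Prod.mk.inj h).1) fun r hr => ⟨hr, le_rfl⟩
  · exact key (fun r => ((b i).1, r)) _ (fun r s h => (Prod.mk.inj h).2) fun r hr => ⟨le_rfl, hr⟩

theorem cont_mem (hb : IsStd k b) {i : ℕ} (hi : i < k) :
    cont (b i) ∈ Finset.Icc (-(i : ℤ)) (i : ℤ) := by
  have := hb.coord_le hi
  simp only [cont, Finset.mem_Icc]
  omega

theorem first (hb : IsStd k b) (hk : 0 < k) : b 0 = 0 := by
  have := hb.coord_le hk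
  exact Prod.ext (by simpa using this.1) (by simpa using this.2)

/-- Two consecutive comparable cells are neighbours. -/
theorem cont_of_le (hb : IsStd k b) {i : ℕ} (hi : i + 1 < k) (h : b i ≤ b (i + 1)) :
    (cont (b (i + 1)) = cont (b i) + 1 ∧ (b i).1 = (b (i + 1)).1) ∨
      (cont (b i) = cont (b (i + 1)) + 1 ∧ (b i).2 = (b (i + 1)).2) := by
  have hne : b i ≠ b (i + 1) := fun e => by have := hb.inj i (i + 1) (by omega) hi e; omega
  -- A cell strictly between the two would need an index strictly between `i` and `i + 1`.
  have key : ∀ c, b i ≤ c → c ≤ b (i + 1) → c ≠ b (i + 1) → b i = c := by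
    intro c h1 h2 h3
    obtain ⟨j, hj, rfl⟩ := hb.lower _ hi _ h2
    have h4 := hb.le_index (by omega) (by omega) h1
    have : j ≠ i + 1 := fun e => h3 (by rw [e])
    rw [show j = i by omega]
  obtain ⟨h1, h2⟩ := Prod.le_def.1 h
  rcases h1.lt_or_eq with h3 | h3
  · right
    have h4 := key ((b (i + 1)).1 - 1, (b (i + 1)).2) (Prod.le_def.2 ⟨by simp only; omega, h2⟩)
      (Prod.le_def.2 ⟨by simp, le_rfl⟩) (fun e => by
        have := congrArg Prod.fst e
        simp only at this
        omega)
    have h5 := congrArg Prod.fst h4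
    have h6 := congrArg Prod.snd h4
    simp only at h5 h6
    simp only [cont]
    omega
  · left
    have h7 : (b i).2 ≠ (b (i + 1)).2 := fun e => hne (Prod.ext h3 e)
    have h4 := key ((b (i + 1)).1, (b (i + 1)).2 - 1) (Prod.le_def.2 ⟨h1, by simp only; omega⟩)
      (Prod.le_def.2 ⟨le_rfl, by simp⟩) (fun e => by
        have := congrArg Prod.snd e
        simp only at this
        omega)
    have h5 := congrArg Prod.fst h4
    have h6 := congrArg Prod.snd h4
    simp only at h5 h6
    simp only [cont]
    omega

end IsStd

theorem comparable_of_cont {c d : ℕ × ℕ} (h : cont d = cont c + 1 ∨ cont c = cont d + 1 ∨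
    cont c = cont d) : c ≤ d ∨ d ≤ c := by
  simp only [cont, Prod.le_def] at h ⊢
  omega

namespace IsStd

variable {k : ℕ} {b : ℕ → ℕ × ℕ}

/-- Cells on one diagonal are comparable, while consecutive comparable cells are neighbours and lie
on different diagonals. This keeps the denominators of the semi-normal form nonzero. -/
theorem cont_ne_succ (hb : IsStd k b) {i : ℕ} (hi : i + 1 < k) : cont (b i) ≠ cont (b (i + 1)) := by
  intro h
  rcases comparable_of_cont (Or.inr (Or.inr h)) with h1 | h1
  · rcases hb.cont_of_le hi h1 with h2 | h2 <;> omega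
  · have := hb.le_index hi (by omega) h1
    omega

/-- On a common diagonal, both the right and the lower neighbour of `b i` would need an index
strictly between `i` and `i + 2`, but there is only one. The braid relation needs this for its third
denominator. -/
theorem cont_ne_succ_succ (hb : IsStd k b) {i : ℕ} (hi : i + 2 < k) :
    cont (b i) ≠ cont (b (i + 2)) := by
  intro h
  have hne : b i ≠ b (i + 2) := fun e => by have := hb.inj i (i + 2) (by omega) hi e; omega
  have hle : b i ≤ b (i + 2) := by
    rcases comparable_of_cont (Or.inr (Or.inr h)) with h1 | h1
    · exact h1
    · have := hb.le_index hi (by omega) h1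
      omega
  have key : ∀ c, b i ≤ c → c ≤ b (i + 2) → c ≠ b i → c ≠ b (i + 2) → c = b (i + 1) := by
    intro c h1 h2 h3 h4
    obtain ⟨j, hj, rfl⟩ := hb.lower _ hi _ h2
    have h5 := hb.le_index (by omega) (by omega) h1
    have : j ≠ i + 2 := fun e => h4 (by rw [e])
    have : j ≠ i := fun e => h3 (by rw [e])
    rw [show j = i + 1 by omega]
  obtain ⟨h1, h2⟩ := Prod.le_def.1 hle
  have h3 : (b i).1 + 1 ≤ (b (i + 2)).1 ∧ (b i).2 + 1 ≤ (b (i + 2)).2 := by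
    have : ¬ ((b i).1 = (b (i + 2)).1 ∧ (b i).2 = (b (i + 2)).2) := fun e => hne (Prod.ext e.1 e.2)
    simp only [cont] at h
    omega
  have e1 := key ((b i).1, (b i).2 + 1) (Prod.le_def.2 ⟨le_rfl, by simp⟩)
    (Prod.le_def.2 ⟨h1, h3.2⟩) (fun e => by have := congrArg Prod.snd e; simp at this)
    (fun e => by have := congrArg Prod.fst e; simp only at this; omega)
  have e2 := key ((b i).1 + 1, (b i).2) (Prod.le_def.2 ⟨by simp, le_rfl⟩)
    (Prod.le_def.2 ⟨h3.1, h2⟩) (fun e => by have := congrArg Prod.fst e; simp at this)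
    (fun e => by have := congrArg Prod.snd e; simp only at this; omega)
  have := congrArg Prod.fst (e1.trans e2.symm)
  simp at this

theorem sw_of_not_le (hb : IsStd k b) {i : ℕ} (hi : i + 1 < k) (h : ¬ b i ≤ b (i + 1)) :
    IsStd k (sw i b) where
  zero j hj := by rw [sw_of_ne b (by omega) (by omega), hb.zero j hj]
  inj j l hj hl e := by
    have := hb.inj
    simp only [sw] at e
    split_ifs at e with h1 h2 h3 h4 h5 h6 h7 h8
    · omega
    · have := hb.inj _ _ hi (by omega) e; omega
    · have := hb.inj _ _ hi hl e; omega
    · have := hb.inj _ _ (by omega) hi e; omega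
    · omega
    · have := hb.inj _ _ (by omega) hl e; omega
    · have := hb.inj _ _ hj hi e; omega
    · have := hb.inj _ _ hj (by omega) e; omega
    · exact hb.inj _ _ hj hl e
  lower j hj c hc := by
    have key : ∀ l, l ≤ j → l ≠ i → l ≠ i + 1 → b l = c → ∃ l', l' ≤ j ∧ sw i b l' = c :=
      fun l h1 h2 h3 h4 => ⟨l, h1, by rw [sw_of_ne b h2 h3, h4]⟩
    by_cases h1 : j = i
    · subst h1
      rw [sw_left] at hc
      obtain ⟨l, hl, e⟩ := hb.lower _ hi c hc
      by_cases h2 : l = j + 1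
      · exact ⟨j, le_rfl, by rw [sw_left, ← h2, e]⟩
      by_cases h3 : l = j
      · rw [h3] at e
        exact absurd (e ▸ hc) h
      exact key l (by omega) h3 h2 e
    by_cases h2 : j = i + 1
    · subst h2
      rw [sw_right] at hc
      obtain ⟨l, hl, e⟩ := hb.lower i (by omega) c hc
      by_cases h3 : l = i
      · exact ⟨i + 1, le_rfl, by rw [sw_right, ← h3, e]⟩
      exact key l (by omega) h3 (by omega) e
    rw [sw_of_ne b h1 h2] at hc
    obtain ⟨l, hl, e⟩ := hb.lower j hj c hc
    by_cases h3 : l = i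
    · exact ⟨i + 1, by omega, by rw [sw_right, ← h3, e]⟩
    by_cases h4 : l = i + 1
    · exact ⟨i, by omega, by rw [sw_left, ← h4, e]⟩
    exact key l hl h3 h4 e

/-- The exchange of two consecutive entries is standard unless their contents differ by one. -/
theorem sw_iff (hb : IsStd k b) {i : ℕ} (hi : i + 1 < k) :
    IsStd k (sw i b) ↔
      ¬ (cont (b (i + 1)) = cont (b i) + 1 ∨ cont (b i) = cont (b (i + 1)) + 1) := by
  constructor
  · intro h1 h2
    rcases comparable_of_cont (c := b i) (d := b (i + 1)) (by tauto) with h3 | h3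
    · have := h1.le_index hi (by omega : i < k) (by rwa [sw_left, sw_right])
      omega
    · have := hb.le_index hi (by omega : i < k) h3
      omega
  · intro h
    refine hb.sw_of_not_le hi fun h1 => h ?_
    rcases hb.cont_of_le hi h1 with h2 | h2
    · exact Or.inl h2.1
    · exact Or.inr h2.1

/-- A tableau is determined by its contents. -/
theorem eq_of_cont {k' : ℕ} {b' : ℕ → ℕ × ℕ} (hb : IsStd k b) (hb' : IsStd k' b') {m : ℕ}
    (hm : m ≤ k) (hm' : m ≤ k') (h : ∀ i < m, cont (b i) = cont (b' i)) : ∀ i < m, b i = b' i := by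
  -- The smaller cell `b i` occurs in `b'` at an index at most `i`; an earlier index would make `b`
  -- repeat a cell. Equal contents make the two cells comparable, so one of the two orders applies.
  have key : ∀ {k k' : ℕ} {b b' : ℕ → ℕ × ℕ} (hb : IsStd k b) (hb' : IsStd k' b') {i : ℕ},
      i < k → i < k' → (∀ j < i, b j = b' j) → b i ≤ b' i → b i = b' i := by
    intro k k' b b' hb hb' i hi hi' hj hle
    obtain ⟨j, hji, e⟩ := hb'.lower i hi' _ hle
    rcases hji.lt_or_eq with h1 | h1
    · have := hb.inj j i (by omega) hi (by rw [hj j h1, e])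
      omega
    · rw [← e, h1]
  intro i
  induction i using Nat.strong_induction_on with
  | _ i ih =>
    intro hi
    rcases comparable_of_cont (Or.inr (Or.inr (h i hi))) with h1 | h1
    · exact key hb hb' (by omega) (by omega) (fun j hj => ih j hj (by omega)) h1
    · exact (key hb' hb (by omega) (by omega) (fun j hj => (ih j hj (by omega)).symm) h1).symm

theorem ext_of_lt {b' : ℕ → ℕ × ℕ} (hb : IsStd k b) (hb' : IsStd k b') (h : ∀ i < k, b i = b' i) :
    b = b' := by
  funext i
  by_cases hi : i < k
  · exact h i hi
  · rw [hb.zero i (by omega), hb'.zero i (by omega)]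

/-- Standard tableaux of the same shape with the same first `m` entries are connected by exchanges of
consecutive later entries. -/
theorem connected {b' : ℕ → ℕ × ℕ} {m : ℕ} {p : (ℕ → ℕ × ℕ) → Prop} (hb : IsStd k b)
    (hb' : IsStd k b') (hs : shape k b = shape k b') (hm : ∀ i < m, b i = b' i)
    (hp : ∀ b i, IsStd k b → IsStd k (sw i b) → m ≤ i → i + 1 < k → p b → p (sw i b))
    (h : p b) : p b' := by
  -- Bubble sort: the cell wanted at position `m'` sits at `m' + d` and is moved down by `d`
  -- exchanges.
  have inner : ∀ (m' d : ℕ) (b : ℕ → ℕ × ℕ), m ≤ m' → IsStd k b → shape k b = shape k b' →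
      (∀ i < m', b i = b' i) → m' + d < k → b (m' + d) = b' m' → p b →
      ∃ b'', IsStd k b'' ∧ shape k b'' = shape k b' ∧ (∀ i < m' + 1, b'' i = b' i) ∧ p b'' := by
    intro m' d
    induction d with
    | zero =>
      intro b _ hb hs hm' _ he h
      refine ⟨b, hb, hs, fun i hi => ?_, h⟩
      by_cases h1 : i = m'
      · rw [h1]; exact he
      · exact hm' i (by omega)
    | succ d ih =>
      intro b hmm hb hs hm' hk he h
      -- The exchange is admissible: a cell below `b' m'` occurs in `b'` no later than `m'`, so it
      -- is already in place in `b` or is `b' m'` itself.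
      have hn : ¬ b (m' + d) ≤ b (m' + d + 1) := by
        intro hle
        rw [show m' + d + 1 = m' + (d + 1) by omega, he] at hle
        obtain ⟨j, hj, e⟩ := hb'.lower m' (by omega) _ hle
        rcases hj.lt_or_eq with h1 | h1
        · have := hb.inj j (m' + d) (by omega) (by omega) (by rw [hm' j h1, e])
          omega
        · rw [h1, ← he] at e
          have := hb.inj _ _ (by omega) (by omega) e
          omega
      have hstd := hb.sw_of_not_le (i := m' + d) (by omega) hn
      refine ih (sw (m' + d) b) hmm hstd (by rw [shape_sw (by omega), hs])
        (fun i hi => by rw [sw_of_ne b (by omega) (by omega), hm' i hi]) (by omega)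
        (by rw [sw_left]; exact he) (hp b _ hb hstd (by omega) (by omega) h)
  have outer : ∀ (d m' : ℕ) (b : ℕ → ℕ × ℕ), k ≤ m' + d → m ≤ m' → IsStd k b →
      shape k b = shape k b' → (∀ i < m', b i = b' i) → p b → p b' := by
    intro d
    induction d with
    | zero =>
      intro m' b hk _ hb _ hm' h
      rwa [← hb.ext_of_lt hb' fun i hi => hm' i (by omega)]
    | succ d ih =>
      intro m' b hk hmm hb hs hm' h
      by_cases hlt : m' < k
      · have hmem : b' m' ∈ shape k b := hs ▸ mem_shape.2 ⟨m', hlt, rfl⟩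
        obtain ⟨j, hj, e⟩ := mem_shape.1 hmem
        have hjm : m' ≤ j := by
          by_contra hc
          have := hb'.inj j m' hj hlt (by rw [← hm' j (by omega), e])
          omega
        obtain ⟨b'', h1, h2, h3, h4⟩ := inner m' (j - m') b hmm hb hs hm' (by omega)
          (by rw [show m' + (j - m') = j by omega, e]) h
        exact ih (m' + 1) b'' (by omega) (by omega) h1 h2 h3 h4
      · rwa [← hb.ext_of_lt hb' fun i hi => hm' i (by omega)]
  exact outer k m b (by omega) le_rfl hb hs hm h

/-- Append a cell to a tableau. -/
theorem update_iff {c : ℕ × ℕ} (hb : ∀ i, k ≤ i → b i = 0) :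
    IsStd (k + 1) (Function.update b k c) ↔
      IsStd k b ∧ c ∉ shape k b ∧ IsLowerSet ((insert c (shape k b) : Finset (ℕ × ℕ)) : Set (ℕ × ℕ)) := by
  have hu : ∀ i, i ≠ k → Function.update b k c i = b i := fun i hi => Function.update_of_ne hi _ _
  constructor
  · intro h
    have h1 : IsStd k b := by
      refine ⟨hb, fun i j hi hj e => h.inj i j (by omega) (by omega) ?_, fun i hi d hd => ?_⟩
      · rw [hu i (by omega), hu j (by omega), e]
      · obtain ⟨j, hj, e⟩ := h.lower i (by omega) d (by rwa [hu i (by omega)])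
        exact ⟨j, hj, by rwa [hu j (by omega)] at e⟩
    have h2 : shape (k + 1) (Function.update b k c) = insert c (shape k b) := by
      rw [shape, Finset.range_add_one, Finset.image_insert, Function.update_self, shape]
      congr 1
      exact Finset.image_congr fun i hi => hu i (by simp at hi; omega)
    refine ⟨h1, fun hc => ?_, h2 ▸ h.isLowerSet_shape⟩
    obtain ⟨i, hi, e⟩ := mem_shape.1 hc
    have := h.inj i k (by omega) (by omega) (by rw [hu i (by omega), e, Function.update_self])
    omega
  · rintro ⟨h1, h2, h3⟩
    refine ⟨fun i hi => by rw [hu i (by omega), hb i (by omega)], fun i j hi hj e => ?_,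
      fun i hi d hd => ?_⟩
    · by_cases hi' : i = k <;> by_cases hj' : j = k
      · omega
      · rw [hi', Function.update_self, hu j hj'] at e
        exact absurd (mem_shape.2 ⟨j, by omega, e.symm⟩) h2
      · rw [hj', Function.update_self, hu i hi'] at e
        exact absurd (mem_shape.2 ⟨i, by omega, e⟩) h2
      · rw [hu i hi', hu j hj'] at e
        exact h1.inj i j (by omega) (by omega) e
    · by_cases hi' : i = k
      · subst hi'
        rw [Function.update_self] at hd
        have := h3 hd (by simp)
        simp only [Finset.coe_insert, Set.mem_insert_iff, Finset.mem_coe] at this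
        rcases this with rfl | h4
        · exact ⟨i, le_rfl, Function.update_self _ _ _⟩
        · obtain ⟨j, hj, e⟩ := mem_shape.1 h4
          exact ⟨j, by omega, by rw [hu j (by omega), e]⟩
      · rw [hu i hi'] at hd
        obtain ⟨j, hj, e⟩ := h1.lower i (by omega) d hd
        exact ⟨j, hj, by rw [hu j (by omega), e]⟩

end IsStd

theorem shape_update (k : ℕ) (b : ℕ → ℕ × ℕ) (c : ℕ × ℕ) :
    shape (k + 1) (Function.update b k c) = insert c (shape k b) := by
  rw [shape, Finset.range_add_one, Finset.image_insert, Function.update_self, shape]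
  congr 1
  exact Finset.image_congr fun i hi => Function.update_of_ne (by simp at hi; omega) _ _


/-! ## Counting pairs of tableaux of the same shape -/

open Classical in
/-- The cells that can be added to a finite lower set. -/
def addable (s : Finset (ℕ × ℕ)) : Finset (ℕ × ℕ) :=
  (Finset.range (s.card + 1) ×ˢ Finset.range (s.card + 1)).filter fun c =>
    c ∉ s ∧ IsLowerSet ((insert c s : Finset (ℕ × ℕ)) : Set (ℕ × ℕ))

open Classical in
/-- The cells that can be removed from a finite lower set. -/
def removable (s : Finset (ℕ × ℕ)) : Finset (ℕ × ℕ) :=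
  s.filter fun c => IsLowerSet ((s.erase c : Finset (ℕ × ℕ)) : Set (ℕ × ℕ))

theorem mem_removable {s : Finset (ℕ × ℕ)} {c : ℕ × ℕ} :
    c ∈ removable s ↔ c ∈ s ∧ IsLowerSet ((s.erase c : Finset (ℕ × ℕ)) : Set (ℕ × ℕ)) := by
  simp [removable]

-- The bounding box in `addable` loses nothing: the cells above an addable cell, and those to its
-- left, lie in `s`, so each coordinate is at most `s.card`.
open Classical in
theorem mem_addable {s : Finset (ℕ × ℕ)} {c : ℕ × ℕ} :
    c ∈ addable s ↔ c ∉ s ∧ IsLowerSet ((insert c s : Finset (ℕ × ℕ)) : Set (ℕ × ℕ)) := by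
  rw [addable, Finset.mem_filter, and_iff_right_iff_imp]
  rintro ⟨-, h2⟩
  have key : ∀ (f : ℕ → ℕ × ℕ) (N : ℕ), Function.Injective f → (∀ r < N, f r ≤ c ∧ f r ≠ c) →
      N ≤ s.card := by
    intro f N hf hle
    have hsub : (Finset.range N).image f ⊆ s := by
      intro d hd
      obtain ⟨r, hr, rfl⟩ := Finset.mem_image.1 hd
      obtain ⟨h3, h4⟩ := hle r (by simpa using hr)
      have := h2 h3 (by simp)
      simp only [Finset.coe_insert, Set.mem_insert_iff, Finset.mem_coe] at this
      exact this.resolve_left h4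
    have h1 := Finset.card_le_card hsub
    rwa [Finset.card_image_of_injective _ hf, Finset.card_range] at h1
  rw [Finset.mem_product, Finset.mem_range, Finset.mem_range]
  constructor
  · refine Nat.lt_succ_of_le (key (fun r => (r, c.2)) _ (fun r s h => (Prod.mk.inj h).1) fun r hr =>
      ⟨⟨hr.le, le_rfl⟩, fun e => ?_⟩)
    have := congrArg Prod.fst e
    simp only at this
    omega
  · refine Nat.lt_succ_of_le (key (fun r => (c.1, r)) _ (fun r s h => (Prod.mk.inj h).2) fun r hr =>
      ⟨⟨le_rfl, hr.le⟩, fun e => ?_⟩)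
    have := congrArg Prod.snd e
    simp only at this
    omega

theorem mem_addable_iff_rowLen (Y : YoungDiagram) (i j : ℕ) :
    (i, j) ∈ addable Y.cells ↔ j = Y.rowLen i ∧ ∀ l, l + 1 = i → Y.rowLen i < Y.rowLen l := by
  have hm : ∀ i j, (i, j) ∈ Y.cells ↔ j < Y.rowLen i := fun i j => YoungDiagram.mem_iff_lt_rowLen
  rw [mem_addable, hm]
  constructor
  · rintro ⟨h1, h2⟩
    have key : ∀ i' j', i' ≤ i → j' ≤ j → (i', j') ≠ (i, j) → j' < Y.rowLen i' := by
      intro i' j' hi hj hne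
      have := h2 (show (i', j') ≤ (i, j) from ⟨hi, hj⟩) (by simp)
      simp only [Finset.coe_insert, Set.mem_insert_iff, Finset.mem_coe] at this
      exact (hm _ _).1 (this.resolve_left hne)
    have hj : j = Y.rowLen i := by
      rcases Nat.eq_zero_or_pos j with h3 | h3
      · omega
      · have := key i (j - 1) le_rfl (by omega) (fun e => by
          have := congrArg Prod.snd e
          simp only at this
          omega)
        omega
    refine ⟨hj, fun l hl => ?_⟩
    have := key l j (by omega) le_rfl (fun e => by
      have := congrArg Prod.fst e
      simp only at this
      omega)
    omega
  · rintro ⟨rfl, h2⟩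
    refine ⟨lt_irrefl _, ?_⟩
    rintro c ⟨i', j'⟩ hdc hc
    simp only [Finset.coe_insert, Set.mem_insert_iff, Finset.mem_coe] at hc ⊢
    rcases hc with rfl | hc
    · obtain ⟨h3, h4⟩ := Prod.le_def.1 hdc
      simp only at h3 h4
      rw [hm]
      rcases h3.lt_or_eq with h5 | h5
      · right
        have h6 := h2 (i - 1) (by omega)
        have h7 := Y.rowLen_anti i' (i - 1) (by omega)
        omega
      · rw [h5]
        rcases h4.lt_or_eq with h6 | h6
        · exact Or.inr h6
        · exact Or.inl (by rw [h6])
    · exact Or.inr (Y.isLowerSet hdc hc)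

theorem mem_removable_iff_rowLen (Y : YoungDiagram) (i j : ℕ) :
    (i, j) ∈ removable Y.cells ↔ j + 1 = Y.rowLen i ∧ Y.rowLen (i + 1) < Y.rowLen i := by
  have hm : ∀ i j, (i, j) ∈ Y.cells ↔ j < Y.rowLen i := fun i j => YoungDiagram.mem_iff_lt_rowLen
  rw [mem_removable, hm]
  constructor
  · rintro ⟨h1, h2⟩
    have key : ∀ i' j', i ≤ i' → j ≤ j' → (i', j') ≠ (i, j) → ¬ j' < Y.rowLen i' := by
      intro i' j' hi hj hne hlt
      have := h2 (show (i, j) ≤ (i', j') from ⟨hi, hj⟩)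
        (Finset.mem_coe.2 (Finset.mem_erase.2 ⟨hne, (hm _ _).2 hlt⟩))
      simp at this
    have h3 := key i (j + 1) le_rfl (by omega) (by simp)
    have h4 := key (i + 1) j (by omega) le_rfl (by simp)
    omega
  · rintro ⟨h1, h2⟩
    refine ⟨by omega, ?_⟩
    rintro ⟨i', j'⟩ d hdc hc
    simp only [Finset.mem_coe, Finset.mem_erase] at hc ⊢
    refine ⟨?_, Y.isLowerSet hdc hc.2⟩
    rintro rfl
    obtain ⟨h3, h4⟩ := Prod.le_def.1 hdc
    simp only at h3 h4
    have h5 := (hm _ _).1 hc.2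
    rcases h3.lt_or_eq with h6 | h6
    · have := Y.rowLen_anti (i + 1) i' (by omega)
      omega
    · subst h6
      exact hc.1 (by rw [show j' = j by omega])

/-- A removable cell ends a row that is strictly longer than the next one, and then the next row can
grow. Row `0` can always grow, which accounts for the extra one. -/
theorem card_addable {s : Finset (ℕ × ℕ)} (hs : IsLowerSet (s : Set (ℕ × ℕ))) :
    (addable s).card = (removable s).card + 1 := by
  let Y : YoungDiagram := ⟨s, hs⟩
  have ha := mem_addable_iff_rowLen Y
  have hr := mem_removable_iff_rowLen Y
  change ∀ i j, (i, j) ∈ addable s ↔ _ at ha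
  change ∀ i j, (i, j) ∈ removable s ↔ _ at hr
  have h1 : addable s = insert (0, Y.rowLen 0)
      ((removable s).image fun c => (c.1 + 1, Y.rowLen (c.1 + 1))) := by
    ext ⟨i, j⟩
    rw [ha, Finset.mem_insert, Finset.mem_image]
    constructor
    · rintro ⟨rfl, h⟩
      rcases i with _ | i
      · exact Or.inl rfl
      · have := h i rfl
        exact Or.inr ⟨(i, Y.rowLen i - 1), (hr _ _).2 ⟨by omega, this⟩, rfl⟩
    · rintro (h | ⟨⟨i', j'⟩, h, e⟩)
      · obtain ⟨rfl, rfl⟩ := Prod.mk.inj h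
        exact ⟨rfl, by omega⟩
      · obtain ⟨rfl, rfl⟩ := Prod.mk.inj e
        refine ⟨rfl, fun l hl => ?_⟩
        obtain rfl : l = i' := by simpa using hl
        exact ((hr _ _).1 h).2
  rw [h1, Finset.card_insert_of_notMem (by simp), Finset.card_image_of_injOn]
  rintro ⟨i, j⟩ h ⟨i', j'⟩ h' e
  obtain rfl : i = i' := by simpa using congrArg Prod.fst e
  have h2 := ((hr _ _).1 (Finset.mem_coe.1 h)).1
  have h3 := ((hr _ _).1 (Finset.mem_coe.1 h')).1
  rw [show j = j' by omega]

/-- The standard tableaux with `k` boxes. -/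
def tabs : ℕ → Finset (ℕ → ℕ × ℕ)
  | 0 => {0}
  | k + 1 => open Classical in (tabs k).biUnion fun b =>
      (addable (shape k b)).image fun c => Function.update b k c

theorem mem_tabs {k : ℕ} {b : ℕ → ℕ × ℕ} : b ∈ tabs k ↔ IsStd k b := by
  induction k generalizing b with
  | zero =>
    rw [tabs, Finset.mem_singleton]
    constructor
    · rintro rfl
      exact ⟨fun _ _ => rfl, fun _ _ h => absurd h (by omega), fun _ h => absurd h (by omega)⟩
    · intro h
      funext i
      exact h.zero i (by omega)
  | succ k ih =>
    simp only [tabs, Finset.mem_biUnion, Finset.mem_image]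
    constructor
    · rintro ⟨b', hb', c, hc, rfl⟩
      have hb' := ih.1 hb'
      exact (IsStd.update_iff hb'.zero).2 ⟨hb', mem_addable.1 hc⟩
    · intro h
      have e : Function.update (Function.update b k 0) k (b k) = b := by simp
      have h0 : ∀ i, k ≤ i → Function.update b k 0 i = 0 := by
        intro i hi
        by_cases h1 : i = k
        · rw [h1, Function.update_self]
        · rw [Function.update_of_ne h1, h.zero i (by omega)]
      have := (IsStd.update_iff (c := b k) h0).1 (by rwa [e])
      exact ⟨_, ih.2 this.1, b k, mem_addable.2 this.2, e⟩

open Classical in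
theorem sum_tabs_succ (k : ℕ) (F : (ℕ → ℕ × ℕ) → ℕ) :
    ∑ b ∈ tabs (k + 1), F b =
      ∑ b ∈ tabs k, ∑ c ∈ addable (shape k b), F (Function.update b k c) := by
  have key : ∀ {b b' : ℕ → ℕ × ℕ} {c c' : ℕ × ℕ}, b ∈ tabs k → b' ∈ tabs k →
      Function.update b k c = Function.update b' k c' → b = b' ∧ c = c' := by
    intro b b' c c' hb hb' e
    refine ⟨(mem_tabs.1 hb).ext_of_lt (mem_tabs.1 hb') fun i hi => ?_, ?_⟩
    · have := congrFun e i
      rwa [Function.update_of_ne hi.ne, Function.update_of_ne hi.ne] at this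
    · simpa using congrFun e k
  rw [tabs, Finset.sum_biUnion]
  · refine Finset.sum_congr rfl fun b hb => Finset.sum_image fun c _ c' _ e => (key hb hb e).2
  · intro b hb b' hb' hne
    rw [Function.onFun, Finset.disjoint_left]
    intro x hx hx'
    obtain ⟨c, -, rfl⟩ := Finset.mem_image.1 hx
    obtain ⟨c', -, e⟩ := Finset.mem_image.1 hx'
    exact hne (key hb' hb e).1.symm

/-- The number of standard tableaux of a given shape. -/
def numTabs (k : ℕ) (s : Finset (ℕ × ℕ)) : ℕ := ∑ b ∈ tabs k, if shape k b = s then 1 else 0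

/-- Branching rule: remove the box with the largest entry. -/
theorem numTabs_succ (k : ℕ) {s : Finset (ℕ × ℕ)} (hs : IsLowerSet (s : Set (ℕ × ℕ))) :
    numTabs (k + 1) s = ∑ c ∈ removable s, numTabs k (s.erase c) := by
  simp only [numTabs]
  rw [sum_tabs_succ, Finset.sum_comm]
  refine Finset.sum_congr rfl fun b hb => ?_
  simp only [shape_update]
  have hlow := (mem_tabs.1 hb).isLowerSet_shape
  rw [← Finset.sum_filter, ← Finset.sum_filter]
  refine Finset.sum_congr ?_ fun _ _ => rfl
  ext c
  rw [Finset.mem_filter, Finset.mem_filter, mem_addable, mem_removable]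
  constructor
  · rintro ⟨⟨h1, h2⟩, rfl⟩
    rw [Finset.erase_insert h1]
    exact ⟨⟨Finset.mem_insert_self _ _, hlow⟩, rfl⟩
  · rintro ⟨⟨h1, h2⟩, e⟩
    rw [e, Finset.insert_erase h1]
    exact ⟨⟨Finset.notMem_erase _ _, hs⟩, rfl⟩

theorem isLowerSet_erase_inter {s : Finset (ℕ × ℕ)} {c d : ℕ × ℕ} (hs : IsLowerSet (s : Set (ℕ × ℕ)))
    (h : IsLowerSet (((insert c s).erase d : Finset (ℕ × ℕ)) : Set (ℕ × ℕ))) :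
    IsLowerSet ((s.erase d : Finset (ℕ × ℕ)) : Set (ℕ × ℕ)) := by
  have : s.erase d = (insert c s).erase d ∩ s := by
    ext x
    simp only [Finset.mem_erase, Finset.mem_inter, Finset.mem_insert]
    tauto
  rw [this, Finset.coe_inter]
  exact h.inter hs

/-- Adding and then removing another cell can be done in the opposite order. -/
theorem addable_removable_comm {s : Finset (ℕ × ℕ)} (hs : IsLowerSet (s : Set (ℕ × ℕ)))
    {c d : ℕ × ℕ} (hcd : c ≠ d) :
    (c ∈ addable s ∧ d ∈ removable (insert c s)) ↔
      (c ∈ addable (s.erase d) ∧ d ∈ removable s) := by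
  rw [mem_addable, mem_addable, mem_removable, mem_removable,
    ← Finset.erase_insert_of_ne hcd]
  constructor
  · rintro ⟨⟨h1, h2⟩, h3, h4⟩
    have h5 : d ∈ s := (Finset.mem_insert.1 h3).resolve_left hcd.symm
    exact ⟨⟨fun h => h1 (Finset.mem_of_mem_erase h), h4⟩, h5, isLowerSet_erase_inter hs h4⟩
  · rintro ⟨⟨h1, h2⟩, h3, h4⟩
    have h5 : c ∉ s := fun h => h1 (Finset.mem_erase.2 ⟨hcd, h⟩)
    refine ⟨⟨h5, ?_⟩, Finset.mem_insert_of_mem h3, h2⟩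
    have : insert c s = (insert c s).erase d ∪ s := by
      ext x
      simp only [Finset.mem_erase, Finset.mem_union, Finset.mem_insert]
      constructor
      · rintro (rfl | h)
        · exact Or.inl ⟨hcd, Or.inl rfl⟩
        · exact Or.inr h
      · tauto
    rw [this, Finset.coe_union]
    exact h2.union hs

/-- Splits off the terms where the cell just added is removed again. There is one for each addable
cell, hence one more than there are removable cells. -/
theorem sum_addable_numTabs_eq (k : ℕ) {s : Finset (ℕ × ℕ)}
    (hs : IsLowerSet (s : Set (ℕ × ℕ))) :
    ∑ c ∈ addable s, numTabs (k + 1) (insert c s) = (removable s).card * numTabs k s +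
      numTabs k s + ∑ c ∈ addable s, ∑ d ∈ (removable (insert c s)).erase c,
        numTabs k ((insert c s).erase d) := by
  rw [← add_one_mul, ← card_addable hs, ← smul_eq_mul, ← Finset.sum_const, ← Finset.sum_add_distrib]
  refine Finset.sum_congr rfl fun c hc => ?_
  obtain ⟨h1, h2⟩ := mem_addable.1 hc
  have h3 : c ∈ removable (insert c s) :=
    mem_removable.2 ⟨Finset.mem_insert_self _ _, by rwa [Finset.erase_insert h1]⟩
  rw [numTabs_succ k h2, ← Finset.add_sum_erase _ _ h3, Finset.erase_insert h1]

/-- This is the relation `DU - UD = 1` of Young's lattice: adding one cell and removing a different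
one commute, and the surplus of one addable cell drives the induction on `k`. -/
theorem sum_addable_numTabs (k : ℕ) {s : Finset (ℕ × ℕ)} (hs : IsLowerSet (s : Set (ℕ × ℕ)))
    (hk : s.card = k) :
    ∑ c ∈ addable s, numTabs (k + 1) (insert c s) = (k + 1) * numTabs k s := by
  induction k generalizing s with
  | zero =>
    have h1 := sum_addable_numTabs_eq 0 hs
    obtain rfl := Finset.card_eq_zero.1 hk
    have h2 : removable ∅ = ∅ := by
      ext c
      simp [mem_removable]
    have h3 : ∀ c : ℕ × ℕ, (removable (insert c ∅)).erase c = ∅ := by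
      intro c
      ext d
      rw [Finset.mem_erase, mem_removable, Finset.mem_insert]
      constructor
      · rintro ⟨h4, h5 | h5, -⟩
        · exact absurd h5 h4
        · exact h5
      · exact fun h => absurd h (Finset.notMem_empty _)
    rw [h1, h2, Finset.sum_eq_zero fun c _ => by rw [h3, Finset.sum_empty]]
    simp
  | succ k ih =>
    have h1 := sum_addable_numTabs_eq (k + 1) hs
    have h2 : (k + 1) * numTabs (k + 1) s = (removable s).card * numTabs (k + 1) s +
        ∑ d ∈ removable s, ∑ c ∈ (addable (s.erase d)).erase d,
          numTabs (k + 1) (insert c (s.erase d)) := by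
      conv_lhs => rw [numTabs_succ k hs, Finset.mul_sum]
      rw [← smul_eq_mul, ← Finset.sum_const, ← Finset.sum_add_distrib]
      refine Finset.sum_congr rfl fun d hd => ?_
      obtain ⟨h3, h4⟩ := mem_removable.1 hd
      have h5 : (s.erase d).card = k := by rw [Finset.card_erase_of_mem h3, hk]; rfl
      have h6 : d ∈ addable (s.erase d) :=
        mem_addable.2 ⟨Finset.notMem_erase _ _, by rwa [Finset.insert_erase h3]⟩
      rw [← ih h4 h5, ← Finset.add_sum_erase _ _ h6, Finset.insert_erase h3]
    have h3 : ∑ c ∈ addable s, ∑ d ∈ (removable (insert c s)).erase c,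
          numTabs (k + 1) ((insert c s).erase d) =
        ∑ d ∈ removable s, ∑ c ∈ (addable (s.erase d)).erase d,
          numTabs (k + 1) (insert c (s.erase d)) := by
      rw [Finset.sum_comm' (t' := removable s) (s' := fun d => (addable (s.erase d)).erase d)]
      · refine Finset.sum_congr rfl fun d hd => Finset.sum_congr rfl fun c hc => ?_
        rw [Finset.erase_insert_of_ne (Finset.ne_of_mem_erase hc)]
      · intro c d
        rw [Finset.mem_erase, Finset.mem_erase]
        by_cases hcd : c = d
        · subst hcd
          tauto
        · have := addable_removable_comm hs hcd
          tauto
    rw [h1, h3, add_one_mul, h2]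
    ring

/-- The number of pairs of standard tableaux of the same shape. -/
theorem sum_numTabs_shape (k : ℕ) : ∑ b ∈ tabs k, numTabs k (shape k b) = k.factorial := by
  induction k with
  | zero => simp [tabs, numTabs, shape]
  | succ k ih =>
    rw [sum_tabs_succ, Nat.factorial_succ, ← ih, Finset.mul_sum]
    refine Finset.sum_congr rfl fun b hb => ?_
    have h := mem_tabs.1 hb
    rw [← sum_addable_numTabs k h.isLowerSet_shape h.card_shape]
    exact Finset.sum_congr rfl fun c _ => by rw [shape_update]


/-! ## The dimension of the Hecke algebras -/

/-- The generator `g_{i+1}` of `H_k`, or `1` if the index is out of range. -/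
def gen' (k i : ℕ) : Hecke k := if h : i < k - 1 then gen ⟨i, h⟩ else 1

theorem gen'_eq {k i : ℕ} (h : i < k - 1) : gen' k i = gen ⟨i, h⟩ := dif_pos h

theorem gen'_braid {k i : ℕ} (h : i + 2 < k) :
    gen' k i * gen' k (i + 1) * gen' k i = gen' k (i + 1) * gen' k i * gen' k (i + 1) := by
  rw [gen'_eq (by omega), gen'_eq (by omega)]
  exact gen_braid _ _ rfl

theorem gen'_comm {k i j : ℕ} (h : i + 2 ≤ j) : gen' k i * gen' k j = gen' k j * gen' k i := by
  by_cases hj : j < k - 1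
  · rw [gen'_eq (by omega), gen'_eq hj]
    exact gen_comm _ _ h
  · rw [gen', gen', dif_neg hj, one_mul, mul_one]

theorem gen'_quad {k i : ℕ} (h : i + 1 < k) :
    gen' k i * gen' k i = (a - a⁻¹) • gen' k i + 1 := by
  rw [gen'_eq (by omega)]
  exact gen_quad _

theorem inl_gen' {m n i : ℕ} (h : i + 1 < m) : inl m n (gen' m i) = gen' (m + n) i := by
  rw [gen'_eq (by omega), gen'_eq (by omega), inl, lift_gen]

theorem inr_gen' {m n i : ℕ} (h : i + 1 < n) : inr m n (gen' n i) = gen' (m + n) (m + i) := by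
  rw [gen'_eq (by omega), gen'_eq (by omega), inr, lift_gen]

/-- The product `g_n g_{n-1} ⋯ g_{n-d+1}` in `H_{n+1}`. -/
def cosetRep (n : ℕ) : ℕ → Hecke (n + 1)
  | 0 => 1
  | d + 1 => cosetRep n d * gen' (n + 1) (n - 1 - d)

theorem cosetRep_comm {n i : ℕ} : ∀ {d : ℕ}, i + 1 + d < n →
    cosetRep n d * gen' (n + 1) i = gen' (n + 1) i * cosetRep n d
  | 0, _ => by rw [cosetRep, one_mul, mul_one]
  | d + 1, h => by
    rw [cosetRep, mul_assoc, ← gen'_comm (by omega), ← mul_assoc, cosetRep_comm (by omega),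
      mul_assoc]

/-- The generator commutes past the later factors until it meets its neighbour; one braid relation
lowers its index, and the result commutes with the remaining factors. -/
theorem cosetRep_shift {n i : ℕ} : ∀ {d : ℕ}, d ≤ n → n < i + 1 + d → i + 1 < n →
    cosetRep n d * gen' (n + 1) (i + 1) = gen' (n + 1) i * cosetRep n d
  | 0, _, h, h' => by omega
  | d + 1, hd, h, h' => by
    rcases (show n < i + 1 + d ∨ n = i + 1 + d by omega) with h1 | h1
    · rw [cosetRep, mul_assoc, gen'_comm (by omega), ← mul_assoc,
        cosetRep_shift (by omega) h1 h', mul_assoc]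
    · rcases d with _ | d
      · omega
      · rw [cosetRep, cosetRep, show n - 1 - (d + 1) = i by omega, show n - 1 - d = i + 1 by omega]
        have h2 := gen'_braid (k := n + 1) (i := i) (by omega)
        calc _ = cosetRep n d * (gen' (n + 1) (i + 1) * gen' (n + 1) i * gen' (n + 1) (i + 1)) := by
              simp only [mul_assoc]
          _ = (cosetRep n d * gen' (n + 1) i) * (gen' (n + 1) (i + 1) * gen' (n + 1) i) := by
              rw [← h2]; simp only [mul_assoc]
          _ = _ := by rw [cosetRep_comm (by omega)]; simp only [mul_assoc]

/-- The map `(y_d) ↦ ∑ y_d g_n ⋯ g_{n-d+1}` from `n + 1` copies of `H_n` to `H_{n+1}`. -/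
def cosetMap (n : ℕ) : (Fin (n + 1) → Hecke n) →ₗ[K] Hecke (n + 1) :=
  ∑ d : Fin (n + 1), (LinearMap.mulRight K (cosetRep n d)).comp
    ((inl n 1).toLinearMap.comp (LinearMap.proj d))

theorem cosetMap_apply (n : ℕ) (y : Fin (n + 1) → Hecke n) :
    cosetMap n y = ∑ d : Fin (n + 1), inl n 1 (y d) * cosetRep n d := by
  simp [cosetMap]

theorem mul_cosetRep_mem {n d : ℕ} (hd : d ≤ n) (y : Hecke n) :
    inl n 1 y * cosetRep n d ∈ LinearMap.range (cosetMap n) := by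
  refine ⟨Pi.single ⟨d, by omega⟩ y, ?_⟩
  rw [cosetMap_apply, Finset.sum_eq_single ⟨d, by omega⟩]
  · simp
  · intro e _ he
    rw [Pi.single_eq_of_ne he, map_zero, zero_mul]
  · simp

/-- In the four cases the generator commutes with the coset representative, lengthens it, shortens
it by the quadratic relation, or passes through it with its index lowered. -/
theorem mul_cosetRep_mul_gen_mem {n d i : ℕ} (hd : d ≤ n) (hi : i < n) (y : Hecke n) :
    inl n 1 y * cosetRep n d * gen' (n + 1) i ∈ LinearMap.range (cosetMap n) := by
  rw [mul_assoc]
  rcases (show i + 1 + d < n ∨ i + 1 + d = n ∨ (i + d = n ∧ 1 ≤ d) ∨ n < i + d by omega) with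
    h | h | ⟨h, h'⟩ | h
  · rw [cosetRep_comm h, ← inl_gen' (by omega), ← mul_assoc, ← map_mul]
    exact mul_cosetRep_mem hd _
  · have : cosetRep n d * gen' (n + 1) i = cosetRep n (d + 1) := by
      rw [cosetRep, show n - 1 - d = i by omega]
    rw [this]
    exact mul_cosetRep_mem (by omega) _
  · obtain ⟨d, rfl⟩ := Nat.exists_eq_add_of_le' h'
    have h1 : cosetRep n (d + 1) = cosetRep n d * gen' (n + 1) i := by
      rw [cosetRep, show n - 1 - d = i by omega]
    have : cosetRep n (d + 1) * gen' (n + 1) i =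
        (a - a⁻¹) • cosetRep n (d + 1) + cosetRep n d := by
      rw [h1, mul_assoc, gen'_quad (by omega), mul_add, mul_smul_comm, mul_one]
    rw [this, mul_add, mul_smul_comm]
    exact Submodule.add_mem _ (Submodule.smul_mem _ _ (mul_cosetRep_mem hd _))
      (mul_cosetRep_mem (by omega) _)
  · obtain ⟨i, rfl⟩ : ∃ i', i = i' + 1 := ⟨i - 1, by omega⟩
    rw [cosetRep_shift hd (by omega) hi, ← inl_gen' (by omega), ← mul_assoc, ← map_mul]
    exact mul_cosetRep_mem hd _

/-- The range is a right ideal that contains `1`. -/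
theorem cosetMap_surjective (n : ℕ) : Function.Surjective (cosetMap n) := by
  rw [← LinearMap.range_eq_top, eq_top_iff]
  have key : ∀ x : Hecke (n + 1), ∀ w ∈ LinearMap.range (cosetMap n),
      w * x ∈ LinearMap.range (cosetMap n) := by
    intro x
    induction x using hecke_induction with
    | hg i =>
      rintro _ ⟨y, rfl⟩
      rw [cosetMap_apply, Finset.sum_mul, ← gen'_eq (k := n + 1) i.2]
      exact Submodule.sum_mem _ fun d _ => mul_cosetRep_mul_gen_mem (by omega) (by omega) _
    | hs r =>
      intro w hw
      rw [← Algebra.commutes, ← Algebra.smul_def]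
      exact Submodule.smul_mem _ _ hw
    | hm x y hx hy =>
      intro w hw
      rw [← mul_assoc]
      exact hy _ (hx _ hw)
    | ha x y hx hy =>
      intro w hw
      rw [mul_add]
      exact Submodule.add_mem _ (hx _ hw) (hy _ hw)
  intro x _
  have := key x _ (mul_cosetRep_mem (Nat.zero_le n) 1)
  rwa [map_one, cosetRep, one_mul, one_mul] at this

/-- Since `H_{k+1}` is a quotient of `k + 1` copies of `H_k`, the bound follows by induction. Only
this inequality is needed; the semi-normal representations supply the opposite one. -/
theorem hecke_finite_finrank_le (k : ℕ) :
    Module.Finite K (Hecke k) ∧ Module.finrank K (Hecke k) ≤ k.factorial := by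
  induction k with
  | zero =>
    have hs : Function.Surjective (Algebra.linearMap K (Hecke 0)) := by
      intro x
      induction x using hecke_induction with
      | hg i => exact absurd i.2 (by omega)
      | hs r => exact ⟨r, rfl⟩
      | hm x y hx hy =>
        obtain ⟨⟨r, rfl⟩, s, rfl⟩ := And.intro hx hy
        exact ⟨r * s, by simp⟩
      | ha x y hx hy =>
        obtain ⟨⟨r, rfl⟩, s, rfl⟩ := And.intro hx hy
        exact ⟨r + s, by simp⟩
    refine ⟨Module.Finite.of_surjective _ hs, ?_⟩
    have := LinearMap.finrank_le_finrank_of_surjective hs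
    simpa using this
  | succ k ih =>
    obtain ⟨h1, h2⟩ := ih
    refine ⟨Module.Finite.of_surjective _ (cosetMap_surjective k), ?_⟩
    have := LinearMap.finrank_le_finrank_of_surjective (cosetMap_surjective k)
    rw [Module.finrank_pi_fintype] at this
    simp only [Finset.sum_const, Finset.card_univ, Fintype.card_fin, smul_eq_mul] at this
    rw [Nat.factorial_succ]
    exact this.trans (Nat.mul_le_mul_left _ h2)


/-! ## The semi-normal representations -/

/-- The parameter is an indeterminate, so its powers are separated by degree. All nonvanishing of
denominators and coefficients rests on this. -/
theorem a_zpow_injective : Function.Injective fun c : ℤ => a ^ c := by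
  have key : ∀ n : ℕ, a ^ n = 1 → n = 0 := by
    intro n h
    have h1 : algebraMap (Polynomial ℂ) K (Polynomial.X ^ n) = algebraMap (Polynomial ℂ) K 1 := by
      rw [map_pow, RatFunc.algebraMap_X, map_one]
      exact h
    have h2 := congrArg Polynomial.natDegree (RatFunc.algebraMap_injective ℂ h1)
    simpa using h2
  have key' : ∀ c d : ℤ, c ≤ d → a ^ c = a ^ d → c = d := by
    intro c d hcd h
    obtain ⟨n, rfl⟩ := Int.le.dest hcd
    rw [zpow_add₀ a_ne_zero, zpow_natCast] at h
    have := key n (mul_left_cancel₀ (zpow_ne_zero c a_ne_zero) (by rw [← h, mul_one]))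
    simp [this]
  intro c d h
  rcases le_total c d with h1 | h1
  · exact key' c d h1 h
  · exact (key' d c h1 h.symm).symm

/-- The eigenvalue of a Jucys-Murphy element at a box of content `c`. -/
def eig (c : ℤ) : K := a ^ (2 * c)

theorem eig_ne_zero (c : ℤ) : eig c ≠ 0 := zpow_ne_zero _ a_ne_zero

theorem eig_injective : Function.Injective eig := fun c d h => by
  have := a_zpow_injective h
  omega

theorem eig_succ (c : ℤ) : eig (c + 1) = a ^ 2 * eig c := by
  rw [eig, eig, mul_add, zpow_add₀ a_ne_zero, mul_comm]
  rfl

theorem a_sq_ne_one : a ^ 2 ≠ 1 := fun h => by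
  have := a_zpow_injective (a₁ := 2) (a₂ := 0) (by simpa using h)
  omega

theorem a_sq_ne_neg_one : a ^ 2 ≠ -1 := fun h => by
  have := a_zpow_injective (a₁ := 4) (a₂ := 0) (by
    simp only [zpow_zero]
    calc a ^ (4 : ℤ) = (a ^ 2) ^ 2 := by rw [← pow_mul]; rfl
      _ = 1 := by rw [h]; ring)
  omega

/-- The diagonal coefficient of `g_i` when the boxes with entries `i`, `i + 1` have contents
`c`, `d`. -/
def coefA (c d : ℤ) : K := (a - a⁻¹) * eig d / (eig d - eig c)

/-- The off-diagonal coefficient of `g_i`. -/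
def coefB (c d : ℤ) : K := if d = c + 1 ∨ c = d + 1 then 0 else a - coefA c d

/-- The trace of a generator on the plane of two exchanged tableaux is the sum of its eigenvalues
`a` and `-a⁻¹`. -/
theorem coefA_add {c d : ℤ} (h : c ≠ d) : coefA c d + coefA d c = a - a⁻¹ := by
  have h1 : eig d - eig c ≠ 0 := sub_ne_zero.2 fun e => h (eig_injective e).symm
  have h2 : eig c - eig d ≠ 0 := sub_ne_zero.2 fun e => h (eig_injective e)
  rw [coefA, coefA]
  field_simp
  ring

theorem coefA_row (c : ℤ) : coefA c (c + 1) = a := by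
  have h1 : a ^ 2 - 1 ≠ 0 := sub_ne_zero.2 a_sq_ne_one
  have h2 := a_ne_zero
  have h3 := eig_ne_zero c
  have h4 : a ^ 2 * eig c - eig c ≠ 0 := by
    rw [← sub_one_mul]
    exact mul_ne_zero h1 h3
  rw [coefA, eig_succ, div_eq_iff h4]
  field_simp

theorem coefA_col (c : ℤ) : coefA (c + 1) c = -a⁻¹ := by
  have := coefA_add (c := c) (d := c + 1) (by omega)
  rw [coefA_row] at this
  linear_combination this

/-- The determinant on the same plane is `-1`. For contents that differ by one both sides vanish, in
agreement with the value `0` of `coefB`. -/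
theorem coefB_mul {c d : ℤ} (h : c ≠ d) : coefB c d * coefB d c = 1 + coefA c d * coefA d c := by
  have h0 := mul_inv_cancel₀ a_ne_zero
  rw [coefB, coefB]
  by_cases h1 : d = c + 1
  · subst h1
    simp only [true_or, if_true, zero_mul, coefA_row, coefA_col]
    linear_combination h0
  by_cases h2 : c = d + 1
  · subst h2
    simp only [true_or, or_true, if_true, zero_mul, coefA_row, coefA_col]
    linear_combination h0
  rw [if_neg (by tauto), if_neg (by tauto)]
  linear_combination a * (-coefA_add h) + h0

/-- `coefA c d = a` would force `eig d = a ^ 2 * eig c`, that is `d = c + 1`. -/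
theorem coefB_ne_zero {c d : ℤ} (h : c ≠ d) (h1 : ¬ (d = c + 1 ∨ c = d + 1)) : coefB c d ≠ 0 := by
  have h2 : eig d - eig c ≠ 0 := sub_ne_zero.2 fun e => h (eig_injective e).symm
  have h3 := a_ne_zero
  rw [coefB, if_neg h1, coefA, sub_ne_zero]
  intro e
  rw [eq_div_iff h2] at e
  field_simp at e
  have h4 : eig d = eig (c + 1) := by
    rw [eig_succ]
    linear_combination e
  exact h1 (Or.inl (eig_injective h4))

/-- A partial fraction identity in the three eigenvalues. -/
theorem coefA_braid {c d e : ℤ} (h1 : c ≠ d) (h2 : d ≠ e) (h3 : c ≠ e) :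
    coefA c d * coefA d e + coefA c e * coefA d c = coefA d e * coefA c e := by
  have e1 : eig d - eig c ≠ 0 := sub_ne_zero.2 fun e => h1 (eig_injective e).symm
  have e2 : eig c - eig d ≠ 0 := sub_ne_zero.2 fun e => h1 (eig_injective e)
  have e3 : eig e - eig d ≠ 0 := sub_ne_zero.2 fun e => h2 (eig_injective e).symm
  have e5 : eig e - eig c ≠ 0 := sub_ne_zero.2 fun e => h3 (eig_injective e).symm
  have key : ∀ q x y z : K, y - x ≠ 0 → x - y ≠ 0 → z - y ≠ 0 → z - x ≠ 0 →
      q * y / (y - x) * (q * z / (z - y)) + q * z / (z - x) * (q * x / (x - y)) =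
        q * z / (z - y) * (q * z / (z - x)) := by
    intro q x y z h1 h2 h3 h4
    have : q * x / (x - y) = - (q * x / (y - x)) := by
      rw [← neg_sub y x]
      exact div_neg _
    rw [this]
    field_simp
    ring
  exact key _ _ _ _ e1 e2 e3 e5

theorem coefA_braid' {c d e : ℤ} (h1 : c ≠ d) (h2 : d ≠ e) (h3 : c ≠ e) :
    coefA c e * coefA e d + coefA d e * coefA c d = coefA c d * coefA c e := by
  have := coefA_braid h1 h2 h3
  linear_combination this + coefA c e * coefA_add h2 - coefA c e * coefA_add h1

section Combinations

variable {R M : Type*} [CommRing R] [AddCommGroup M] [Module R M]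

theorem quad_combination {A B A' B' q : R} (h1 : A + A' = q) (h2 : B * B' = 1 + A * A') (u v : M) :
    A • (A • u + B • v) + B • (A' • v + B' • u) = q • (A • u + B • v) + u := by
  linear_combination (norm := module) (h2 + A * h1) • u + (B * h1) • v

theorem comm_combination (A B C D : R) (u v w x : M) :
    A • (C • u + D • v) + B • (C • w + D • x) = C • (A • u + B • w) + D • (A • v + B • x) := by
  module

theorem jucysMurphy_combination {A B A' B' c d : R} (h1 : B * B' = 1 + A * A')
    (h2 : A * c + A' * d = 0) (u v : M) :
    A • c • (A • u + B • v) + B • d • (A' • v + B' • u) = d • u := by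
  linear_combination (norm := module) (d * h1 + A * h2) • u + (B * h2) • v

/-- The braid relation on six tableaux permuted by two exchanges. The coefficients of `v` and `w`
are the two partial fraction identities, that of `u` also uses the quadratic relations, and those of
`x`, `y`, `z` agree identically. -/
theorem braid_combination {p q r p' q' P P' Q Q' T : R} (h1 : p * q + r * p' = q * r)
    (h2 : r * q' + q * p = p * r) (h3 : P * P' = 1 + p * p') (h4 : Q * Q' = 1 + q * q')
    (u v w x y z : M) :
    p • (q • (p • u + P • v) + Q • (r • w + T • x)) +
        P • (r • (p' • v + P' • u) + T • (q • y + Q • z)) =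
      q • (p • (q • u + Q • w) + P • (r • v + T • y)) +
        Q • (r • (q' • w + Q' • u) + T • (p • x + P • z)) := by
  have h5 : p * q * p + P * P' * r = q * p * q + Q * Q' * r := by
    rw [h3, h4]
    linear_combination p * h1 - q * h2
  linear_combination (norm := module) h5 • u + (P * h1) • v - (Q * h2) • w

end Combinations

/-- Standard tableaux with `k` boxes. -/
abbrev Tab (k : ℕ) : Type := {b : ℕ → ℕ × ℕ // IsStd k b}

/-- The sum of the semi-normal representations of `H_k`. -/
abbrev Seminormal (k : ℕ) : Type := Tab k →₀ K

open Classical in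
/-- The basis vector of a standard tableau; `0` for other sequences of cells. -/
def vec (k : ℕ) (b : ℕ → ℕ × ℕ) : Seminormal k :=
  if h : IsStd k b then Finsupp.single ⟨b, h⟩ 1 else 0

theorem vec_of_std {k : ℕ} {b : ℕ → ℕ × ℕ} (h : IsStd k b) :
    vec k b = Finsupp.single ⟨b, h⟩ 1 := dif_pos h

theorem vec_of_not_std {k : ℕ} {b : ℕ → ℕ × ℕ} (h : ¬ IsStd k b) : vec k b = 0 := dif_neg h

theorem vec_ne_zero {k : ℕ} {b : ℕ → ℕ × ℕ} (h : IsStd k b) : vec k b ≠ 0 := by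
  rw [vec_of_std h]
  simp

theorem seminormal_hom_ext {k : ℕ} {M : Type*} [AddCommGroup M] [Module K M]
    {f g : Seminormal k →ₗ[K] M} (h : ∀ b, IsStd k b → f (vec k b) = g (vec k b)) : f = g := by
  refine Finsupp.lhom_ext' fun b => LinearMap.ext_ring ?_
  have := h b.1 b.2
  rwa [vec_of_std b.2] at this

/-- The action of `g_{i+1}`. -/
def genOp (k i : ℕ) : Module.End K (Seminormal k) :=
  Finsupp.linearCombination K fun b : Tab k =>
    coefA (cont (b.1 i)) (cont (b.1 (i + 1))) • vec k b.1 +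
      coefB (cont (b.1 i)) (cont (b.1 (i + 1))) • vec k (sw i b.1)

/-- Valid without standardness: if only the exchanged sequence is standard, its two contents differ
by one and `coefB` vanishes. The relations can therefore be expanded without case distinctions. -/
theorem genOp_vec {k i : ℕ} (hi : i + 1 < k) (b : ℕ → ℕ × ℕ) :
    genOp k i (vec k b) = coefA (cont (b i)) (cont (b (i + 1))) • vec k b +
      coefB (cont (b i)) (cont (b (i + 1))) • vec k (sw i b) := by
  by_cases h : IsStd k b
  · conv_lhs => rw [vec_of_std h, genOp, Finsupp.linearCombination_single, one_smul]
  · rw [vec_of_not_std h, map_zero, smul_zero, zero_add]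
    by_cases h' : IsStd k (sw i b)
    · have := h'.sw_iff hi
      rw [sw_sw, sw_left, sw_right] at this
      rw [coefB, if_pos (by tauto), zero_smul]
    · rw [vec_of_not_std h', smul_zero]

theorem genOp_quad {k i : ℕ} (hi : i + 1 < k) :
    genOp k i * genOp k i = (a - a⁻¹) • genOp k i + 1 := by
  refine seminormal_hom_ext fun b hb => ?_
  have h1 := hb.cont_ne_succ hi
  simp only [Module.End.mul_apply, LinearMap.add_apply, LinearMap.smul_apply, Module.End.one_apply,
    genOp_vec hi, map_add, map_smul, sw_left, sw_right, sw_sw]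
  generalize cont (b i) = c at *
  generalize cont (b (i + 1)) = d at *
  exact quad_combination (coefA_add h1) (coefB_mul h1) _ _

theorem genOp_comm {k i j : ℕ} (hj : j + 1 < k) (h : i + 2 ≤ j) :
    genOp k i * genOp k j = genOp k j * genOp k i := by
  refine seminormal_hom_ext fun b hb => ?_
  have e1 := sw_of_ne (i := i) (j := j) b (by omega) (by omega)
  have e2 := sw_of_ne (i := i) (j := j + 1) b (by omega) (by omega)
  have e3 := sw_of_ne (i := j) (j := i) b (by omega) (by omega)
  have e4 := sw_of_ne (i := j) (j := i + 1) b (by omega) (by omega)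
  simp only [Module.End.mul_apply, genOp_vec hj, genOp_vec (show i + 1 < k by omega), map_add,
    map_smul, e1, e2, e3, e4, sw_comm h]
  exact comm_combination _ _ _ _ _ _ _ _

theorem genOp_braid {k i : ℕ} (hi : i + 2 < k) :
    genOp k i * genOp k (i + 1) * genOp k i = genOp k (i + 1) * genOp k i * genOp k (i + 1) := by
  refine seminormal_hom_ext fun b hb => ?_
  have h1 := hb.cont_ne_succ (i := i) (by omega)
  have h2 := hb.cont_ne_succ (i := i + 1) (by omega)
  have h3 := hb.cont_ne_succ_succ hi
  have e1 : ∀ b, sw i b (i + 1 + 1) = b (i + 1 + 1) :=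
    fun b => sw_of_ne b (by omega) (by omega)
  have e2 : ∀ b, sw (i + 1) b i = b i := fun b => sw_of_ne b (by omega) (by omega)
  simp only [Module.End.mul_apply, genOp_vec (show i + 1 < k by omega),
    genOp_vec (show i + 1 + 1 < k by omega), map_add, map_smul, e1, e2, sw_left, sw_right, sw_sw,
    sw_braid]
  rw [show i + 2 = i + 1 + 1 from rfl] at h3
  generalize cont (b i) = c at *
  generalize cont (b (i + 1)) = d at *
  generalize cont (b (i + 1 + 1)) = e at *
  exact braid_combination (coefA_braid h1 h2 h3) (coefA_braid' h1 h2 h3) (coefB_mul h1)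
    (coefB_mul h2) _ _ _ _ _ _

/-- The sum of the semi-normal representations, as a representation of `H_k`. -/
def rep (k : ℕ) : Hecke k →ₐ[K] Module.End K (Seminormal k) :=
  lift (fun i => genOp k i.1)
    (fun i j h => by rw [← h]; exact genOp_braid (by omega))
    (fun i j h => genOp_comm (by omega) h) (fun i => genOp_quad (by omega))

theorem rep_gen {k i : ℕ} (hi : i < k - 1) : rep k (gen ⟨i, hi⟩) = genOp k i := by
  rw [rep, lift_gen]

theorem rep_gen_vec {k i : ℕ} (hi : i < k - 1) (b : ℕ → ℕ × ℕ) :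
    rep k (gen ⟨i, hi⟩) (vec k b) = coefA (cont (b i)) (cont (b (i + 1))) • vec k b +
      coefB (cont (b i)) (cont (b (i + 1))) • vec k (sw i b) := by
  rw [rep_gen, genOp_vec (by omega)]

theorem rep_jucysMurphy {k : ℕ} {b : ℕ → ℕ × ℕ} (hb : IsStd k b) :
    ∀ i : ℕ, i < k → rep k (jucysMurphy k i) (vec k b) = eig (cont (b i)) • vec k b := by
  -- As `L_{i+1} = g_i L_i g_i`, the induction step for `b` also uses the hypothesis for the
  -- exchanged tableau, so `b` must vary.
  have key : ∀ (i : ℕ), i < k → ∀ b, IsStd k b →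
      rep k (jucysMurphy k i) (vec k b) = eig (cont (b i)) • vec k b := by
    intro i
    induction i with
    | zero =>
      intro hk b hb
      rw [hb.first hk, jucysMurphy, map_one]
      simp [cont, eig]
    | succ i ih =>
      intro hk b hb
      have h1 := hb.cont_ne_succ hk
      have h2 : rep k (jucysMurphy k i) (vec k (sw i b)) =
          eig (cont (b (i + 1))) • vec k (sw i b) := by
        by_cases h : IsStd k (sw i b)
        · rw [ih (by omega) _ h, sw_left]
        · rw [vec_of_not_std h, map_zero, smul_zero]
      rw [jucysMurphy, dif_pos (by omega), map_mul, map_mul, rep_gen]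
      simp only [Module.End.mul_apply, genOp_vec hk, map_add, map_smul, h2, ih (by omega) b hb,
        sw_left, sw_right, sw_sw]
      generalize cont (b i) = c at *
      generalize cont (b (i + 1)) = d at *
      have k1 := coefB_mul h1
      have k2 : coefA c d * eig c + coefA d c * eig d = 0 := by
        have h1 : eig d - eig c ≠ 0 := sub_ne_zero.2 fun e => h1 (eig_injective e).symm
        have h2 : eig c - eig d ≠ 0 := by rwa [← neg_sub, neg_ne_zero]
        rw [coefA, coefA]
        field_simp
        ring
      exact jucysMurphy_combination k1 k2 _ _
  exact fun i hi => key i hi b hb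

/-- Elements of `H_k` preserve the span of the tableaux of a given shape. -/
theorem rep_shape {k : ℕ} (h : Hecke k) (b : ℕ → ℕ × ℕ) :
    rep k h (vec k b) ∈ Finsupp.supported K K {S : Tab k | shape k S.1 = shape k b} := by
  have hv : ∀ b', shape k b' = shape k b →
      vec k b' ∈ Finsupp.supported K K {S : Tab k | shape k S.1 = shape k b} := by
    intro b' hs
    by_cases h1 : IsStd k b'
    · rw [vec_of_std h1]
      exact Finsupp.single_mem_supported _ _ hs
    · rw [vec_of_not_std h1]
      exact Submodule.zero_mem _
  have key : ∀ v ∈ Finsupp.supported K K {S : Tab k | shape k S.1 = shape k b},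
      rep k h v ∈ Finsupp.supported K K {S : Tab k | shape k S.1 = shape k b} := by
    induction h using hecke_induction with
    | hg i =>
      intro v hv'
      rw [Finsupp.supported_eq_span_single] at hv'
      induction hv' using Submodule.span_induction with
      | mem x hx =>
        obtain ⟨S, hS, rfl⟩ := hx
        have e : vec k S.1 = Finsupp.single S 1 := vec_of_std S.2
        change rep k (gen ⟨i.1, i.2⟩) (Finsupp.single S 1) ∈ _
        rw [← e, rep_gen_vec i.2]
        exact Submodule.add_mem _ (Submodule.smul_mem _ _ (hv _ hS))
          (Submodule.smul_mem _ _ (hv _ (by rw [shape_sw (by omega)]; exact hS)))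
      | zero => rw [map_zero]; exact Submodule.zero_mem _
      | add x y _ _ hx hy => rw [map_add]; exact Submodule.add_mem _ hx hy
      | smul r x _ hx => rw [map_smul]; exact Submodule.smul_mem _ _ hx
    | hs r =>
      intro v hv'
      rw [AlgHom.commutes]
      exact Submodule.smul_mem _ _ hv'
    | hm x y hx hy =>
      intro v hv'
      rw [map_mul]
      exact hx _ (hy _ hv')
    | ha x y hx hy =>
      intro v hv'
      rw [map_add]
      exact Submodule.add_mem _ (hx _ hv') (hy _ hv')
  exact key _ (hv b rfl)

/-! ## Projections to basis vectors -/

theorem lagrange_eval {s : Finset ℤ} {c d : ℤ} (hc : c ∈ s) (hd : d ∈ s) :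
    (Lagrange.basis s (fun c : ℤ => a ^ (2 * c)) c).eval (eig d) = if d = c then 1 else 0 := by
  split_ifs with h
  · subst h
    exact Lagrange.eval_basis_self (v := eig) eig_injective.injOn hc
  · exact Lagrange.eval_basis_of_ne (v := eig) (fun e => h e.symm) hd

/-- The product of Lagrange interpolation polynomials in the first `m` Jucys-Murphy elements of
`H_k` for the contents of `b`. -/
def prefixIdem (k m : ℕ) (b : ℕ → ℕ × ℕ) : Hecke k :=
  (List.ofFn fun i : Fin m => Polynomial.aeval (jucysMurphy k i)
      (Lagrange.basis (Finset.Icc (-(i.1 : ℤ)) (i.1 : ℤ)) (fun c : ℤ => a ^ (2 * c))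
        (cont (b i)))).prod

theorem aeval_apply_of_eig {k : ℕ} {x : Hecke k} {v : Seminormal k} {r : K}
    (h : rep k x v = r • v) (p : Polynomial K) :
    rep k (Polynomial.aeval x p) v = p.eval r • v := by
  rw [← Polynomial.aeval_algHom_apply]
  exact Module.End.aeval_apply_of_mem_apply_eq_smul h

theorem rep_prod_ofFn {k m : ℕ} (x : Fin m → Hecke k) (r : Fin m → K) {v : Seminormal k}
    (h : ∀ i, rep k (x i) v = r i • v) : rep k (List.ofFn x).prod v = (∏ i, r i) • v := by
  induction m with
  | zero => simp
  | succ m ih =>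
    rw [List.ofFn_succ, List.prod_cons, map_mul, Module.End.mul_apply,
      ih _ (fun i => r i.succ) fun i => h i.succ, map_smul, h 0, Fin.prod_univ_succ, smul_smul,
      mul_comm]

-- The Jucys-Murphy elements are diagonal, so each interpolation factor is `1` or `0` according to
-- whether the contents agree, and the first `m` contents determine the first `m` cells.
open Classical in
theorem rep_prefixIdem {k m k' : ℕ} (hm : m ≤ k) (hm' : m ≤ k') {b S : ℕ → ℕ × ℕ}
    (hb : IsStd k' b) (hS : IsStd k S) :
    rep k (prefixIdem k m b) (vec k S) = if ∀ i < m, S i = b i then vec k S else 0 := by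
  rw [prefixIdem, rep_prod_ofFn _ (fun i => if cont (S i) = cont (b i) then 1 else 0)]
  · split_ifs with h
    · rw [Finset.prod_eq_one fun i _ => by rw [if_pos (by rw [h i i.2])], one_smul]
    · have : ¬ ∀ i < m, cont (S i) = cont (b i) := fun h' => h (hS.eq_of_cont hb hm hm' h')
      push Not at this
      obtain ⟨i, hi, hne⟩ := this
      rw [Finset.prod_eq_zero (Finset.mem_univ ⟨i, hi⟩) (if_neg hne), zero_smul]
  · intro i
    rw [aeval_apply_of_eig (rep_jucysMurphy hS i (by omega)),
      lagrange_eval (hb.cont_mem (by omega)) (hS.cont_mem (by omega))]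


/-! ## Faithfulness of the semi-normal representations -/

instance tabFintype (k : ℕ) : Fintype (Tab k) := Fintype.subtype (tabs k) fun _ => mem_tabs

theorem rep_prefixIdem_self {k : ℕ} {b S : ℕ → ℕ × ℕ} (hb : IsStd k b) (hS : IsStd k S) :
    rep k (prefixIdem k k b) (vec k S) = open Classical in if S = b then vec k b else 0 := by
  rw [rep_prefixIdem le_rfl le_rfl hb hS]
  by_cases h : S = b
  · subst h
    simp
  · rw [if_neg h, if_neg fun h' => h (hS.ext_of_lt hb h')]

open Classical in
/-- The matrix units of the semi-normal representations lie in the image of `H_k`. -/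
theorem exists_matrixUnit {k : ℕ} {S T : ℕ → ℕ × ℕ} (hS : IsStd k S) (hT : IsStd k T)
    (h : shape k S = shape k T) :
    ∃ x : Hecke k, ∀ S', IsStd k S' → rep k x (vec k S') = if S' = S then vec k T else 0 := by
  refine hS.connected (m := 0) (p := fun T => ∃ x : Hecke k, ∀ S', IsStd k S' →
    rep k x (vec k S') = if S' = S then vec k T else 0) hT h (fun i hi => absurd hi (by omega)) ?_
    ⟨prefixIdem k k S, fun S' hS' => by rw [rep_prefixIdem_self hS hS']⟩
  rintro b i hb hb' - hi ⟨x, hx⟩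
  have h1 := coefB_ne_zero (hb.cont_ne_succ hi) ((hb.sw_iff hi).1 hb')
  have h2 : b ≠ sw i b := fun e => by
    have := congrFun e i
    rw [sw_left] at this
    have := hb.inj _ _ (by omega) hi this
    omega
  -- The generator creates the exchanged tableau, the idempotent removes the diagonal term, and the
  -- scalar normalizes the rest.
  refine ⟨(coefB (cont (b i)) (cont (b (i + 1))))⁻¹ •
    (prefixIdem k k (sw i b) * gen ⟨i, by omega⟩ * x), fun S' hS' => ?_⟩
  rw [map_smul, map_mul, map_mul, LinearMap.smul_apply, Module.End.mul_apply, Module.End.mul_apply,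
    hx S' hS']
  split_ifs with h3
  · rw [rep_gen_vec, map_add, map_smul, map_smul, rep_prefixIdem_self hb' hb,
      rep_prefixIdem_self hb' hb', if_neg h2, if_pos rfl, smul_zero, zero_add, smul_smul,
      inv_mul_cancel₀ h1, one_smul]
  · rw [map_zero, map_zero, smul_zero]

/-- Pairs of tableaux of the same shape. -/
abbrev TabPair (k : ℕ) : Type := {p : Tab k × Tab k // shape k p.2.1 = shape k p.1.1}

instance tabPairFintype (k : ℕ) : Fintype (TabPair k) := Fintype.ofFinite _

theorem card_tabPair (k : ℕ) : Fintype.card (TabPair k) = k.factorial := by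
  classical
  rw [← sum_numTabs_shape, Fintype.card_subtype, Finset.card_filter, Fintype.sum_prod_type]
  simp only [numTabs]
  rw [Finset.sum_subtype (tabs k) (p := IsStd k) fun _ => mem_tabs]
  refine Finset.sum_congr rfl fun b _ => ?_
  rw [Finset.sum_subtype (tabs k) (p := IsStd k) fun _ => mem_tabs]

/-- The matrix coefficients of the semi-normal representations. -/
def coefMap (k : ℕ) : Hecke k →ₗ[K] (TabPair k → K) :=
  LinearMap.pi fun p => (Finsupp.lapply p.1.2).comp
    ((LinearMap.applyₗ (vec k p.1.1.1)).comp (rep k).toLinearMap)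

theorem coefMap_apply {k : ℕ} (x : Hecke k) (p : TabPair k) :
    coefMap k x p = rep k x (vec k p.1.1.1) p.1.2 := rfl

theorem coefMap_surjective (k : ℕ) : Function.Surjective (coefMap k) := by
  classical
  choose x hx using fun p : TabPair k => exists_matrixUnit p.1.1.2 p.1.2.2 p.2.symm
  intro f
  refine ⟨∑ p, f p • x p, ?_⟩
  funext q
  rw [map_sum, Finset.sum_apply, Finset.sum_eq_single q]
  · rw [map_smul, Pi.smul_apply, coefMap_apply, hx q _ q.1.1.2, if_pos rfl, vec_of_std q.1.2.2]
    simp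
  · intro p _ hp
    rw [map_smul, Pi.smul_apply, coefMap_apply, hx p _ q.1.1.2]
    split_ifs with h
    · rw [vec_of_std p.1.2.2, Finsupp.single_eq_of_ne, smul_zero]
      intro h'
      exact hp (Subtype.ext (Prod.ext (Subtype.ext h.symm) h'.symm))
    · simp
  · simp

/-- A surjection from a space of dimension at most `k!` to one of dimension `k!` is injective. -/
theorem coefMap_injective (k : ℕ) : Function.Injective (coefMap k) := by
  obtain ⟨h1, h2⟩ := hecke_finite_finrank_le k
  have h3 := LinearMap.finrank_le_finrank_of_surjective (coefMap_surjective k)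
  have h4 : Module.finrank K (TabPair k → K) = k.factorial := by
    rw [Module.finrank_fintype_fun_eq_card, card_tabPair]
  exact (LinearMap.injective_iff_surjective_of_finrank_eq_finrank (by omega)).2
    (coefMap_surjective k)

theorem eq_of_rep {k : ℕ} {x y : Hecke k}
    (h : ∀ b, IsStd k b → rep k x (vec k b) = rep k y (vec k b)) : x = y := by
  refine coefMap_injective k (funext fun p => ?_)
  rw [coefMap_apply, coefMap_apply, h _ p.1.1.2]

/-! ## Coordinates -/

open Classical in
/-- The coordinate belonging to a tableau; `0` for other sequences of cells. -/
def coord (k : ℕ) (S : ℕ → ℕ × ℕ) : Seminormal k →ₗ[K] K :=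
  if h : IsStd k S then Finsupp.lapply ⟨S, h⟩ else 0

theorem coord_of_std {k : ℕ} {S : ℕ → ℕ × ℕ} (h : IsStd k S) (w : Seminormal k) :
    coord k S w = w ⟨S, h⟩ := by
  rw [coord, dif_pos h, Finsupp.lapply_apply]

open Classical in
theorem coord_vec {k : ℕ} {S b : ℕ → ℕ × ℕ} (hb : IsStd k b) :
    coord k S (vec k b) = if b = S then 1 else 0 := by
  by_cases h : IsStd k S
  · rw [coord_of_std h, vec_of_std hb, Finsupp.single_apply]
    simp
  · rw [coord, dif_neg h, if_neg (by rintro rfl; exact h hb), LinearMap.zero_apply]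

theorem eq_zero_of_coord {k : ℕ} {w : Seminormal k} (h : ∀ S, IsStd k S → coord k S w = 0) :
    w = 0 := by
  ext S
  rw [← coord_of_std S.2, h _ S.2, Finsupp.zero_apply]

/-- The transposed action: the coefficient comes from the exchanged tableau, hence the reversed
arguments of `coefB`. -/
theorem coord_genOp {k i : ℕ} (hi : i + 1 < k) (S : ℕ → ℕ × ℕ) (w : Seminormal k) :
    coord k S (genOp k i w) = coefA (cont (S i)) (cont (S (i + 1))) * coord k S w +
      coefB (cont (S (i + 1))) (cont (S i)) * coord k (sw i S) w := by
  classical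
  have key : (coord k S).comp (genOp k i) = coefA (cont (S i)) (cont (S (i + 1))) • coord k S +
      coefB (cont (S (i + 1))) (cont (S i)) • coord k (sw i S) := by
    refine seminormal_hom_ext fun b hb => ?_
    rw [LinearMap.comp_apply, genOp_vec hi, map_add, map_smul, map_smul, LinearMap.add_apply,
      LinearMap.smul_apply, LinearMap.smul_apply, coord_vec hb, coord_vec hb]
    congr 1
    · split_ifs with h
      · rw [h]
      · rw [smul_zero, smul_zero]
    · by_cases h : b = sw i S
      · subst h
        rw [sw_sw, sw_left, sw_right, if_pos rfl]
        by_cases h' : IsStd k S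
        · rw [coord_vec h', if_pos rfl]
        · have := hb.sw_iff hi
          rw [sw_sw, sw_left, sw_right] at this
          rw [coefB, if_pos (by tauto), zero_smul, zero_smul]
      · rw [if_neg h, smul_zero]
        by_cases h' : IsStd k (sw i b)
        · rw [coord_vec h', if_neg, smul_zero]
          rintro rfl
          exact h (sw_sw i b).symm
        · rw [vec_of_not_std h', map_zero, smul_zero]
  exact LinearMap.congr_fun key w

theorem coord_prefixIdem {k m k' : ℕ} (hm : m ≤ k) (hm' : m ≤ k') {c S : ℕ → ℕ × ℕ}
    (hc : IsStd k' c) (w : Seminormal k) (h : ¬ ∀ i < m, S i = c i) :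
    coord k S (rep k (prefixIdem k m c) w) = 0 := by
  classical
  have key : (coord k S).comp (rep k (prefixIdem k m c)) = 0 := by
    refine seminormal_hom_ext fun b hb => ?_
    rw [LinearMap.comp_apply, rep_prefixIdem hm hm' hc hb, LinearMap.zero_apply]
    split_ifs with h'
    · rw [coord_vec hb, if_neg]
      rintro rfl
      exact h h'
    · exact map_zero _
  exact LinearMap.congr_fun key w

/-! ## Morphisms as vectors -/

theorem prefixIdem_mul_self {k m k' : ℕ} (hm : m ≤ k) (hm' : m ≤ k') {c : ℕ → ℕ × ℕ}
    (hc : IsStd k' c) : prefixIdem k m c * prefixIdem k m c = prefixIdem k m c := by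
  refine eq_of_rep fun b hb => ?_
  rw [map_mul, Module.End.mul_apply, rep_prefixIdem hm hm' hc hb]
  split_ifs with h
  · rw [rep_prefixIdem hm hm' hc hb, if_pos h]
  · exact map_zero _

/-- A morphism is zero if its vector is. -/
theorem eq_zero_of_rep_vec {k : ℕ} {b : ℕ → ℕ × ℕ} {x : Hecke k} (hb : IsStd k b)
    (hx : x * prefixIdem k k b = x) (h : rep k x (vec k b) = 0) : x = 0 := by
  refine eq_of_rep fun S hS => ?_
  rw [← hx, map_mul, Module.End.mul_apply, rep_prefixIdem_self hb hS, map_zero,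
    LinearMap.zero_apply]
  split_ifs
  · exact h
  · exact map_zero _

/-- The vector of a morphism is supported on tableaux of the same shape that extend `c`. -/
theorem coord_rep_vec {k m k' : ℕ} (hm : m ≤ k) (hm' : m ≤ k') {b c S : ℕ → ℕ × ℕ} {x : Hecke k}
    (hc : IsStd k' c) (hx : prefixIdem k m c * x = x)
    (h : coord k S (rep k x (vec k b)) ≠ 0) :
    IsStd k S ∧ shape k S = shape k b ∧ ∀ i < m, S i = c i := by
  have hS : IsStd k S := by
    by_contra hS
    rw [coord, dif_neg hS] at h
    exact h rfl
  refine ⟨hS, ?_, ?_⟩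
  · by_contra hne
    have := (Finsupp.mem_supported' K _).1 (rep_shape x b) ⟨S, hS⟩ hne
    rw [coord_of_std hS] at h
    exact h this
  · by_contra hne
    rw [← hx, map_mul, Module.End.mul_apply, coord_prefixIdem hm hm' hc _ hne] at h
    exact h rfl

/-- Every basis vector in the support condition comes from a morphism. -/
theorem exists_hom_vec {k m k' : ℕ} (hm : m ≤ k) (hm' : m ≤ k') {b c S : ℕ → ℕ × ℕ}
    (hb : IsStd k b) (hc : IsStd k' c) (hS : IsStd k S) (hs : shape k S = shape k b)
    (h : ∀ i < m, S i = c i) :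
    ∃ x ∈ Hom (prefixIdem k k b) (prefixIdem k m c), rep k x (vec k b) = vec k S := by
  obtain ⟨x, hx⟩ := exists_matrixUnit hb hS hs.symm
  refine ⟨prefixIdem k m c * x * prefixIdem k k b, ⟨?_, ?_⟩, ?_⟩
  · rw [← mul_assoc, ← mul_assoc, prefixIdem_mul_self hm hm' hc]
  · rw [mul_assoc, prefixIdem_mul_self le_rfl le_rfl hb]
  · rw [map_mul, map_mul, Module.End.mul_apply, Module.End.mul_apply, rep_prefixIdem_self hb hb,
      if_pos rfl, hx b hb, if_pos rfl, rep_prefixIdem hm hm' hc hS, if_pos h]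

/-! ## Compatibility with the embeddings -/

theorem inl_jucysMurphy (m n : ℕ) : ∀ {i : ℕ}, i < m →
    inl m n (jucysMurphy m i) = jucysMurphy (m + n) i
  | 0, _ => by rw [jucysMurphy, jucysMurphy, map_one]
  | i + 1, h => by
    rw [jucysMurphy, jucysMurphy, dif_pos (by omega), dif_pos (by omega), map_mul, map_mul,
      inl_jucysMurphy m n (by omega), inl, lift_gen]

theorem inl_prefixIdem {m n j : ℕ} (hj : j ≤ m) (b : ℕ → ℕ × ℕ) :
    inl m n (prefixIdem m j b) = prefixIdem (m + n) j b := by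
  rw [prefixIdem, map_list_prod, List.map_ofFn, prefixIdem]
  congr 2
  funext i
  rw [Function.comp_apply, ← Polynomial.aeval_algHom_apply, inl_jucysMurphy m n (by omega)]

/-- Append the cell `c` to every tableau. -/
def extend (k : ℕ) (c : ℕ × ℕ) : Seminormal k →ₗ[K] Seminormal (k + 1) :=
  Finsupp.linearCombination K fun b : Tab k => vec (k + 1) (Function.update b.1 k c)

theorem extend_vec {k : ℕ} {c : ℕ × ℕ} {b : ℕ → ℕ × ℕ} (hb : ∀ i, k ≤ i → b i = 0) :
    extend k c (vec k b) = vec (k + 1) (Function.update b k c) := by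
  by_cases h : IsStd k b
  · rw [vec_of_std h, extend, Finsupp.linearCombination_single, one_smul]
  · rw [vec_of_not_std h, map_zero, vec_of_not_std]
    exact fun h' => h ((IsStd.update_iff hb).1 h').1

/-- The generators of `H_k` only see the first `k` boxes. Appending an inadmissible cell gives the
zero vector, which `rep_gen_vec` also covers. -/
theorem rep_inl_extend {k : ℕ} (c : ℕ × ℕ) (h : Hecke k) (v : Seminormal k) :
    rep (k + 1) (inl k 1 h) (extend k c v) = extend k c (rep k h v) := by
  induction h using hecke_induction generalizing v with
  | hg i =>
    obtain ⟨i, hi⟩ := i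
    have key : (rep (k + 1) (inl k 1 (gen ⟨i, hi⟩))).comp (extend k c) =
        (extend k c).comp (rep k (gen ⟨i, hi⟩)) := by
      refine seminormal_hom_ext fun b hb => ?_
      have e1 : sw i (Function.update b k c) = Function.update (sw i b) k c := by
        funext j
        simp only [sw, Function.update_apply]
        split_ifs <;> first | omega | rfl
      have e2 : ∀ j, k ≤ j → sw i b j = 0 := fun j hj => by
        rw [sw_of_ne b (by omega) (by omega), hb.zero j hj]
      rw [LinearMap.comp_apply, LinearMap.comp_apply, extend_vec hb.zero, inl, lift_gen,
        rep_gen_vec, rep_gen_vec, map_add, map_smul, map_smul, extend_vec hb.zero, extend_vec e2, e1,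
        Function.update_of_ne (by omega), Function.update_of_ne (by omega)]
    exact LinearMap.congr_fun key v
  | hs r => rw [AlgHom.commutes, AlgHom.commutes, AlgHom.commutes]; exact ((extend k c).map_smul r v).symm
  | hm x y hx hy =>
    rw [map_mul, map_mul, map_mul, Module.End.mul_apply, Module.End.mul_apply, hy, hx]
  | ha x y hx hy =>
    rw [map_add, map_add, map_add, LinearMap.add_apply, LinearMap.add_apply, map_add, hx, hy]

/-! ## The symmetrizer -/

/-- The tableau with one row. -/
def rowTab (n : ℕ) : ℕ → ℕ × ℕ := fun i => if i < n then (0, i) else 0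

theorem isStd_rowTab (n : ℕ) : IsStd n (rowTab n) where
  zero i hi := if_neg (by omega)
  inj i j hi hj h := by
    rw [rowTab, rowTab, if_pos hi, if_pos hj] at h
    exact (Prod.mk.inj h).2
  lower i hi c hc := by
    rw [rowTab, if_pos hi] at hc
    obtain ⟨h1, h2⟩ := Prod.le_def.1 hc
    simp only at h1 h2
    refine ⟨c.2, h2, ?_⟩
    rw [rowTab, if_pos (by omega)]
    exact Prod.ext (by simp only; omega) rfl

theorem cont_rowTab {n i : ℕ} (hi : i < n) : cont (rowTab n i) = i := by
  rw [rowTab, if_pos hi]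
  simp [cont]

theorem triv_gen {n : ℕ} (i : Fin (n - 1)) : triv n (gen i) = a := by
  rw [triv, lift_gen]

theorem rep_rowTab {n : ℕ} (h : Hecke n) :
    rep n h (vec n (rowTab n)) = triv n h • vec n (rowTab n) := by
  induction h using hecke_induction with
  | hg i =>
    rw [triv_gen, rep_gen_vec i.2, cont_rowTab (by omega), cont_rowTab (by omega), Nat.cast_succ,
      coefA_row, coefB, if_pos (Or.inl rfl), zero_smul, add_zero]
  | hs r => rw [AlgHom.commutes, AlgHom.commutes]; rfl
  | hm x y hx hy =>
    rw [map_mul, map_mul, Module.End.mul_apply, hy, map_smul, hx, smul_smul, mul_comm]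
  | ha x y hx hy => rw [map_add, map_add, LinearMap.add_apply, hx, hy, add_smul]

theorem coord_rowTab {n : ℕ} (h : Hecke n) (w : Seminormal n) :
    coord n (rowTab n) (rep n h w) = triv n h * coord n (rowTab n) w := by
  induction h using hecke_induction generalizing w with
  | hg i =>
    rw [triv_gen, rep_gen i.2, coord_genOp (by omega), cont_rowTab (by omega),
      cont_rowTab (by omega), Nat.cast_succ, coefA_row, coefB, if_pos (Or.inr rfl), zero_mul,
      add_zero]
  | hs r =>
    rw [AlgHom.commutes, AlgHom.commutes]
    exact (coord n (rowTab n)).map_smul r w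
  | hm x y hx hy => rw [map_mul, map_mul, Module.End.mul_apply, hx, hy, mul_assoc]
  | ha x y hx hy => rw [map_add, map_add, LinearMap.add_apply, map_add, hx, hy, add_mul]

/-- The `q`-symmetrizer: an idempotent that spans the trivial representation. -/
theorem exists_symmetrizer (n : ℕ) : ∃ p : Hecke n, triv n p = 1 ∧
    (∀ h, h * p = triv n h • p) ∧ ∀ h, p * h = triv n h • p := by
  classical
  have hr := isStd_rowTab n
  have h1 : ∀ w, rep n (prefixIdem n n (rowTab n)) w =
      coord n (rowTab n) w • vec n (rowTab n) := by
    intro w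
    have key : rep n (prefixIdem n n (rowTab n)) =
        (coord n (rowTab n)).smulRight (vec n (rowTab n)) := by
      refine seminormal_hom_ext fun b hb => ?_
      rw [rep_prefixIdem_self hr hb, LinearMap.smulRight_apply, coord_vec hb]
      split_ifs
      · rw [one_smul]
      · rw [zero_smul]
    rw [key, LinearMap.smulRight_apply]
  -- The idempotent of the one-row tableau has rank one. Its vector and its coordinate functional
  -- are both eigenvectors for `triv`, which gives the left and the right identity.
  refine ⟨prefixIdem n n (rowTab n), ?_, fun h => ?_, fun h => ?_⟩
  · have h2 := rep_rowTab (prefixIdem n n (rowTab n))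
    rw [rep_prefixIdem_self hr hr, if_pos rfl] at h2
    have h3 : (triv n (prefixIdem n n (rowTab n)) - 1) • vec n (rowTab n) = 0 := by
      rw [sub_smul, one_smul, ← h2, sub_self]
    exact sub_eq_zero.1 ((smul_eq_zero.1 h3).resolve_right (vec_ne_zero hr))
  · refine eq_of_rep fun b hb => ?_
    rw [map_mul, Module.End.mul_apply, h1, map_smul, map_smul, LinearMap.smul_apply, h1, rep_rowTab,
      smul_comm]
  · refine eq_of_rep fun b hb => ?_
    rw [map_mul, Module.End.mul_apply, h1, map_smul, LinearMap.smul_apply, h1, coord_rowTab,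
      mul_smul]


/-! ## Tableaux of skew shape -/

namespace StdTab

variable {lam mu : YoungDiagram} {n : ℕ}

/-- The sequence of cells of a skew tableau. -/
def fn (P : StdTab lam mu n) : ℕ → ℕ × ℕ := fun i => if h : i < n then (P.pos ⟨i, h⟩).1 else 0

theorem fn_of_lt (P : StdTab lam mu n) {i : ℕ} (h : i < n) : P.fn i = (P.pos ⟨i, h⟩).1 := dif_pos h

theorem fn_mem (P : StdTab lam mu n) {i : ℕ} (h : i < n) : P.fn i ∈ mu.cells ∧ P.fn i ∉ lam.cells := by
  rw [P.fn_of_lt h]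
  exact Finset.mem_sdiff.1 (P.pos ⟨i, h⟩).2

theorem exists_fn (P : StdTab lam mu n) {c : ℕ × ℕ} (h : c ∈ mu.cells) (h' : c ∉ lam.cells) :
    ∃ i < n, P.fn i = c := by
  refine ⟨P.pos.symm ⟨c, Finset.mem_sdiff.2 ⟨h, h'⟩⟩, Fin.is_lt _, ?_⟩
  rw [P.fn_of_lt (Fin.is_lt _)]
  simp

theorem fn_le (P : StdTab lam mu n) {i j : ℕ} (hi : i < n) (hj : j < n) (h : P.fn i ≤ P.fn j) :
    i ≤ j := by
  rw [P.fn_of_lt hi, P.fn_of_lt hj] at h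
  exact P.increasing _ _ h

/-- The tableau `b` of shape `λ`, with `m` boxes, followed by a tableau of shape `μ \ λ`. -/
def glue (m : ℕ) (b : ℕ → ℕ × ℕ) (P : StdTab lam mu n) : ℕ → ℕ × ℕ :=
  fun i => if i < m then b i else P.fn (i - m)

theorem glue_of_lt {m : ℕ} (b : ℕ → ℕ × ℕ) (P : StdTab lam mu n) {i : ℕ} (h : i < m) :
    P.glue m b i = b i := if_pos h

theorem glue_add (m : ℕ) (b : ℕ → ℕ × ℕ) (P : StdTab lam mu n) (i : ℕ) :
    P.glue m b (m + i) = P.fn i := by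
  rw [glue, if_neg (by omega), Nat.add_sub_cancel_left]

theorem isStd_glue {m : ℕ} {b : ℕ → ℕ × ℕ} (P : StdTab lam mu n) (hb : IsStd m b)
    (hs : SkewHecke.shape m b = lam.cells) : IsStd (m + n) (P.glue m b) where
  zero i hi := by
    obtain ⟨j, rfl⟩ := Nat.exists_eq_add_of_le (show m ≤ i by omega)
    rw [glue_add, fn, dif_neg (by omega)]
  inj := by
    have key : ∀ i j, i < m → j < n → P.glue m b i ≠ P.glue m b (m + j) := by
      intro i j hi hj h
      rw [glue_add, P.glue_of_lt b hi] at h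
      exact (P.fn_mem hj).2 (hs ▸ mem_shape.2 ⟨i, hi, h⟩)
    intro i j hi hj h
    rcases lt_or_ge i m with h1 | h1 <;> rcases lt_or_ge j m with h2 | h2
    · rw [P.glue_of_lt b h1, P.glue_of_lt b h2] at h
      exact hb.inj i j h1 h2 h
    · obtain ⟨j, rfl⟩ := Nat.exists_eq_add_of_le h2
      exact absurd h (key i j h1 (by omega))
    · obtain ⟨i, rfl⟩ := Nat.exists_eq_add_of_le h1
      exact absurd h.symm (key j i h2 (by omega))
    · obtain ⟨i, rfl⟩ := Nat.exists_eq_add_of_le h1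
      obtain ⟨j, rfl⟩ := Nat.exists_eq_add_of_le h2
      rw [glue_add, glue_add] at h
      have h3 := P.fn_le (by omega) (by omega) h.le
      have h4 := P.fn_le (by omega) (by omega) h.ge
      omega
  lower i hi c hc := by
    rcases lt_or_ge i m with h1 | h1
    · rw [P.glue_of_lt b h1] at hc
      obtain ⟨j, hj, e⟩ := hb.lower i h1 c hc
      exact ⟨j, hj, by rw [P.glue_of_lt b (by omega), e]⟩
    · obtain ⟨i, rfl⟩ := Nat.exists_eq_add_of_le h1
      rw [glue_add] at hc
      by_cases h2 : c ∈ lam.cells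
      · rw [← hs] at h2
        obtain ⟨j, hj, e⟩ := mem_shape.1 h2
        exact ⟨j, by omega, by rw [P.glue_of_lt b hj, e]⟩
      · obtain ⟨j, hj, rfl⟩ := P.exists_fn (mu.isLowerSet hc (P.fn_mem (by omega)).1) h2
        have := P.fn_le hj (by omega) hc
        exact ⟨m + j, by omega, P.glue_add m b j⟩

theorem shape_glue {m : ℕ} {b : ℕ → ℕ × ℕ} (P : StdTab lam mu n) (hle : lam ≤ mu)
    (hs : SkewHecke.shape m b = lam.cells) : SkewHecke.shape (m + n) (P.glue m b) = mu.cells := by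
  ext c
  rw [mem_shape]
  constructor
  · rintro ⟨i, hi, rfl⟩
    rcases lt_or_ge i m with h1 | h1
    · rw [P.glue_of_lt b h1]
      exact hle (hs ▸ mem_shape.2 ⟨i, h1, rfl⟩ : b i ∈ lam.cells)
    · obtain ⟨i, rfl⟩ := Nat.exists_eq_add_of_le h1
      rw [glue_add]
      exact (P.fn_mem (by omega)).1
  · intro hc
    by_cases h2 : c ∈ lam.cells
    · rw [← hs] at h2
      obtain ⟨j, hj, e⟩ := mem_shape.1 h2
      exact ⟨j, by omega, by rw [P.glue_of_lt b hj, e]⟩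
    · obtain ⟨j, hj, rfl⟩ := P.exists_fn hc h2
      exact ⟨m + j, by omega, P.glue_add m b j⟩

theorem glue_zero (P : StdTab lam mu n) (b : ℕ → ℕ × ℕ) : P.glue 0 b = P.fn := by
  funext i
  rw [glue, if_neg (by omega), Nat.sub_zero]

theorem isStd_fn {nu : YoungDiagram} {k : ℕ} (T : StdTab ⊥ nu k) : IsStd k T.fn := by
  have := T.isStd_glue (m := 0) (b := 0) (mem_tabs.1 (by simp [tabs])) (by simp [SkewHecke.shape])
  rwa [glue_zero, Nat.zero_add] at this

theorem shape_fn {nu : YoungDiagram} {k : ℕ} (T : StdTab ⊥ nu k) :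
    SkewHecke.shape k T.fn = nu.cells := by
  have := T.shape_glue (m := 0) (b := 0) bot_le (by simp [SkewHecke.shape])
  rwa [glue_zero, Nat.zero_add] at this

/-- Reading a skew shape by columns, vertical neighbours get consecutive entries. -/
theorem exists_column_reading (h : (mu.cells \ lam.cells).card = n) {i j : ℕ}
    (h1 : (i, j) ∈ mu.cells \ lam.cells) (h2 : (i + 1, j) ∈ mu.cells \ lam.cells) :
    ∃ (P : StdTab lam mu n) (l : ℕ), l + 1 < n ∧ P.fn l = (i, j) ∧ P.fn (l + 1) = (i + 1, j) := by
  -- Swapping the coordinates makes the lexicographic order compare columns first.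
  let f : ℕ × ℕ ≃ ℕ ×ₗ ℕ := (Equiv.prodComm ℕ ℕ).trans toLex
  let s : Finset (ℕ ×ₗ ℕ) := (mu.cells \ lam.cells).map f.toEmbedding
  have hs : s.card = n := by simpa [s] using h
  let o := s.orderIsoOfFin hs
  have hmem : ∀ c : ℕ ×ₗ ℕ, c ∈ s ↔ f.symm c ∈ mu.cells \ lam.cells := by
    intro c
    simp only [s, Finset.mem_map_equiv]
  let q : {c // c ∈ s} ≃ {c // c ∈ mu.cells \ lam.cells} := f.symm.subtypeEquiv hmem
  let P : StdTab lam mu n := ⟨o.toEquiv.trans q, by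
    intro i j hij
    refine o.le_iff_le.1 (show (o i).1 ≤ (o j).1 from ?_)
    obtain ⟨h3, h4⟩ := Prod.le_def.1 hij
    exact Prod.Lex.toLex_mono (show ((f.symm (o i).1).2, (f.symm (o i).1).1) ≤
      ((f.symm (o j).1).2, (f.symm (o j).1).1) from ⟨h4, h3⟩)⟩
  have hP : ∀ l (hl : l < n), P.fn l = f.symm (o ⟨l, hl⟩).1 := fun l hl => P.fn_of_lt hl
  obtain ⟨l, hl, e⟩ := P.exists_fn (Finset.mem_sdiff.1 h1).1 (Finset.mem_sdiff.1 h1).2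
  obtain ⟨l', hl', e'⟩ := P.exists_fn (Finset.mem_sdiff.1 h2).1 (Finset.mem_sdiff.1 h2).2
  have h3 : l ≤ l' := P.fn_le hl hl' (by rw [e, e']; exact ⟨by simp, le_rfl⟩)
  have h4 : l ≠ l' := by
    rintro rfl
    rw [e] at e'
    simpa using congrArg Prod.fst e'
  -- An entry in between would be a pair lexicographically between `(j, i)` and `(j, i + 1)`.
  have h5 : l' = l + 1 := by
    by_contra hne
    have h6 : l + 1 < n := by omega
    have a1 : (o ⟨l, hl⟩).1 < (o ⟨l + 1, h6⟩).1 := o.lt_iff_lt.2 (by simp [Fin.lt_def])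
    have a2 : (o ⟨l + 1, h6⟩).1 < (o ⟨l', hl'⟩).1 := o.lt_iff_lt.2 (by simp [Fin.lt_def]; omega)
    have b1 : (o ⟨l, hl⟩).1 = toLex (j, i) := by
      have := hP l hl
      rw [e] at this
      exact (f.symm_apply_eq.1 this.symm)
    have b2 : (o ⟨l', hl'⟩).1 = toLex (j, i + 1) := by
      have := hP l' hl'
      rw [e'] at this
      exact (f.symm_apply_eq.1 this.symm)
    rw [b1, Prod.Lex.lt_iff] at a1
    rw [b2, Prod.Lex.lt_iff] at a2
    simp only [ofLex_toLex] at a1 a2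
    omega
  exact ⟨P, l, by omega, e, h5 ▸ e'⟩

end StdTab

theorem simpleIdem_eq {nu : YoungDiagram} {k : ℕ} (T : StdTab ⊥ nu k) :
    simpleIdem T = prefixIdem k k T.fn := by
  rw [simpleIdem, prefixIdem]
  congr 2
  funext i
  rw [StdTab.content, cont, T.fn_of_lt i.2]

theorem tensor_boxPow_eq {m n : ℕ} (e : Hecke m) : tensor e (boxPow n) = inl m n e := by
  rw [tensor, boxPow, map_one, mul_one]

theorem tensor_simple_boxPow {m n : ℕ} {nu : YoungDiagram} (T : StdTab ⊥ nu m) :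
    tensor (simpleIdem T) (boxPow n) = prefixIdem (m + n) m T.fn := by
  rw [tensor_boxPow_eq, simpleIdem_eq, inl_prefixIdem le_rfl]

/-- Tensoring with `□^n` turns the full idempotent of `λ` into a prefix idempotent of `H_{m+n}`,
which projects to the tableaux that start with the chosen tableau of `λ`. -/
theorem skewRep_eq (t : Choice) {m n : ℕ} (lam : Ptn m) (mu : Ptn (m + n)) :
    SkewRep t lam mu = Hom (prefixIdem (m + n) (m + n) (t _ mu).fn)
      (prefixIdem (m + n) m (t m lam).fn) := by
  rw [SkewRep, simple, simple, tensor_simple_boxPow, simpleIdem_eq]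

theorem card_skew {m n : ℕ} (lam : Ptn m) (mu : Ptn (m + n)) (hle : lam.1 ≤ mu.1) :
    (mu.1.cells \ lam.1.cells).card = n := by
  rw [Finset.card_sdiff_of_subset (YoungDiagram.cells_subset_iff.2 hle)]
  have h1 := lam.2
  have h2 := mu.2
  simp only [YoungDiagram.card] at h1 h2
  omega


/-! ## Invariant vectors -/

section Invariants

variable {m n : ℕ} {b c : ℕ → ℕ × ℕ} {x : Hecke (m + n)}

/-- The `S`-coordinate of `g_i x = a x`; it links the coordinates at `S` and at the exchanged
tableau. -/
theorem coord_invariant (hi : ∀ h, inr m n h * x = triv n h • x) {i : ℕ} (h : i + 1 < n)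
    (S : ℕ → ℕ × ℕ) :
    coefA (cont (S (m + i))) (cont (S (m + i + 1))) * coord (m + n) S (rep (m + n) x (vec (m + n) b)) +
      coefB (cont (S (m + i + 1))) (cont (S (m + i))) *
        coord (m + n) (sw (m + i) S) (rep (m + n) x (vec (m + n) b)) =
      a * coord (m + n) S (rep (m + n) x (vec (m + n) b)) := by
  have h1 := hi (gen' n i)
  rw [inr_gen' h, gen'_eq (by omega), gen'_eq (by omega), triv_gen] at h1
  rw [← coord_genOp (by omega), ← rep_gen (by omega), ← Module.End.mul_apply, ← map_mul, h1,
    map_smul, LinearMap.smul_apply, map_smul, smul_eq_mul]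

/-- An invariant morphism is zero if one of its coordinates is. -/
theorem eq_zero_of_invariant (hb : IsStd (m + n) b) (hc : IsStd m c)
    (hx : x ∈ Hom (prefixIdem (m + n) (m + n) b) (prefixIdem (m + n) m c))
    (hi : ∀ h, inr m n h * x = triv n h • x) {S : ℕ → ℕ × ℕ} (hS : IsStd (m + n) S)
    (hs : shape (m + n) S = shape (m + n) b) (hSc : ∀ i < m, S i = c i)
    (h0 : coord (m + n) S (rep (m + n) x (vec (m + n) b)) = 0) : x = 0 := by
  refine eq_zero_of_rep_vec hb hx.2 (eq_zero_of_coord fun T hT => ?_)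
  by_contra hne
  obtain ⟨-, h2, h3⟩ := coord_rep_vec (by omega) le_rfl hc hx.1 hne
  refine hne (hS.connected (m := m)
    (p := fun T => coord (m + n) T (rep (m + n) x (vec (m + n) b)) = 0) hT (hs.trans h2.symm)
    (fun i h => (hSc i h).trans (h3 i h).symm) ?_ h0)
  intro T i hT hT' hmi hi' hz
  obtain ⟨i, rfl⟩ := Nat.exists_eq_add_of_le hmi
  have h4 := coord_invariant (b := b) hi (i := i) (by omega) T
  -- What remains is `coefB` times the coordinate at the exchanged tableau; both tableaux are
  -- standard, so this factor is nonzero.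
  rw [hz, mul_zero, mul_zero, zero_add] at h4
  refine (mul_eq_zero.1 h4).resolve_left (coefB_ne_zero (hT.cont_ne_succ hi').symm fun h5 => ?_)
  exact (hT.sw_iff hi').1 hT' h5.symm

/-- An invariant morphism is zero if some tableau has vertical neighbours with consecutive entries. -/
theorem eq_zero_of_column (hb : IsStd (m + n) b) (hc : IsStd m c)
    (hx : x ∈ Hom (prefixIdem (m + n) (m + n) b) (prefixIdem (m + n) m c))
    (hi : ∀ h, inr m n h * x = triv n h • x) {S : ℕ → ℕ × ℕ} (hS : IsStd (m + n) S)
    (hs : shape (m + n) S = shape (m + n) b) (hSc : ∀ i < m, S i = c i) {i : ℕ} (h : i + 1 < n)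
    (hcol : cont (S (m + i)) = cont (S (m + i + 1)) + 1) : x = 0 := by
  refine eq_zero_of_invariant hb hc hx hi hS hs hSc ?_
  have h1 := coord_invariant (b := b) hi h S
  rw [hcol, coefA_col, coefB, if_pos (Or.inl rfl), zero_mul, add_zero] at h1
  -- The diagonal coefficient of vertical neighbours is `-a⁻¹`, so the coordinate is annihilated by
  -- `a + a⁻¹`.
  have h2 : (a ^ 2 + 1) * coord (m + n) S (rep (m + n) x (vec (m + n) b)) = 0 := by
    linear_combination -a * h1 - coord (m + n) S (rep (m + n) x (vec (m + n) b)) *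
      mul_inv_cancel₀ a_ne_zero
  refine (mul_eq_zero.1 h2).resolve_left fun h3 => a_sq_ne_neg_one ?_
  linear_combination h3

/-- The sum of all coordinates. -/
def coordSum (k : ℕ) : Seminormal k →ₗ[K] K := Finsupp.linearCombination K fun _ => 1

theorem coordSum_vec {k : ℕ} {b : ℕ → ℕ × ℕ} (hb : IsStd k b) : coordSum k (vec k b) = 1 := by
  rw [vec_of_std hb, coordSum, Finsupp.linearCombination_single, smul_eq_mul, mul_one]

/-- On tableaux that extend one of shape `λ` by a horizontal strip, the later generators multiply the
sum of the coordinates by `a`. -/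
theorem coordSum_genOp {lam mu : YoungDiagram} (hst : HorizontalStrip lam mu) (hc : shape m c = lam.cells)
    {i : ℕ} (h : i + 1 < n) {S : ℕ → ℕ × ℕ} (hS : IsStd (m + n) S)
    (hs : shape (m + n) S = mu.cells) (hSc : ∀ i < m, S i = c i) :
    coordSum (m + n) (genOp (m + n) (m + i) (vec (m + n) S)) = a := by
  have hi : m + i + 1 < m + n := by omega
  rw [genOp_vec hi, map_add, map_smul, map_smul, coordSum_vec hS, smul_eq_mul, mul_one]
  by_cases hT : IsStd (m + n) (sw (m + i) S)
  -- Here the normalization pays off: `coefB` was defined as `a - coefA`.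
  · rw [coordSum_vec hT, coefB, if_neg ((hS.sw_iff hi).1 hT), smul_eq_mul, mul_one]
    ring
  · rw [vec_of_not_std hT, map_zero, smul_zero, add_zero]
    have hle : S (m + i) ≤ S (m + i + 1) := by
      by_contra hle
      exact hT (hS.sw_of_not_le hi hle)
    -- Boxes that cannot be exchanged are neighbours. In a row the coefficient is `a`; a common
    -- column is excluded by the strip condition.
    rcases hS.cont_of_le hi hle with h1 | h1
    · rw [h1.1, coefA_row]
    · have hmem : ∀ j, m ≤ j → j < m + n → S j ∈ mu.cells \ lam.cells := by
        intro j hj hj'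
        rw [Finset.mem_sdiff, ← hs, ← hc, mem_shape, mem_shape]
        refine ⟨⟨j, hj', rfl⟩, ?_⟩
        rintro ⟨l, hl, e⟩
        have := hS.inj l j (by omega) hj' (by rw [hSc l hl, e])
        omega
      have h2 := hst.2 _ (hmem (m + i) (by omega) (by omega)) _
        (hmem (m + i + 1) (by omega) (by omega)) h1.2
      have := hS.inj _ _ (by omega) hi h2
      omega

theorem mem_span_of_hom (hc : IsStd m c)
    (hx : x ∈ Hom (prefixIdem (m + n) (m + n) b) (prefixIdem (m + n) m c)) :
    rep (m + n) x (vec (m + n) b) ∈ Submodule.span K (vec (m + n) ''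
      {S | IsStd (m + n) S ∧ shape (m + n) S = shape (m + n) b ∧ ∀ i < m, S i = c i}) := by
  rw [← Finsupp.sum_single (rep (m + n) x (vec (m + n) b))]
  refine Submodule.sum_mem _ fun S hS => ?_
  rw [Finsupp.mem_support_iff, ← coord_of_std S.2] at hS
  have h1 : vec (m + n) S.1 = Finsupp.single S 1 := vec_of_std S.2
  rw [← mul_one (rep (m + n) x (vec (m + n) b) S), ← smul_eq_mul, ← Finsupp.smul_single, ← h1]
  exact Submodule.smul_mem _ _ (Submodule.subset_span
    ⟨S.1, coord_rep_vec (by omega) le_rfl hc hx.1 hS, rfl⟩)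

/-- For a horizontal strip the sum of the coordinates is an equivariant functional to the trivial
representation. -/
theorem coordSum_inr {lam mu : YoungDiagram} (hst : HorizontalStrip lam mu)
    (hbs : shape (m + n) b = mu.cells) (hc : IsStd m c) (hcs : shape m c = lam.cells) (h : Hecke n)
    (hx : x ∈ Hom (prefixIdem (m + n) (m + n) b) (prefixIdem (m + n) m c)) :
    coordSum (m + n) (rep (m + n) (inr m n h * x) (vec (m + n) b)) =
      triv n h * coordSum (m + n) (rep (m + n) x (vec (m + n) b)) := by
  have hstable : ∀ (h : Hecke n) {y : Hecke (m + n)},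
      y ∈ Hom (prefixIdem (m + n) (m + n) b) (prefixIdem (m + n) m c) →
      inr m n h * y ∈ Hom (prefixIdem (m + n) (m + n) b) (prefixIdem (m + n) m c) := by
    rintro h y ⟨h1, h2⟩
    refine ⟨?_, by rw [mul_assoc, h2]⟩
    rw [← inl_prefixIdem le_rfl] at h1 ⊢
    rw [← mul_assoc, (inl_inr_commute _ _).eq, mul_assoc, h1]
  induction h using hecke_induction generalizing x with
  | hg i =>
    obtain ⟨i, hi⟩ := i
    rw [triv_gen, map_mul, Module.End.mul_apply, inr, lift_gen, rep_gen]
    have h1 := mem_span_of_hom hc hx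
    generalize rep (m + n) x (vec (m + n) b) = w at h1
    induction h1 using Submodule.span_induction with
    | mem w hw =>
      obtain ⟨S, ⟨h2, h3, h4⟩, rfl⟩ := hw
      rw [coordSum_genOp hst hcs (by omega) h2 (h3.trans hbs) h4, coordSum_vec h2, mul_one]
    | zero => rw [map_zero, map_zero, mul_zero]
    | add x y _ _ hx hy => rw [map_add, map_add, map_add, hx, hy, mul_add]
    | smul r x _ hx =>
      rw [map_smul, map_smul, map_smul, hx, smul_eq_mul, smul_eq_mul]
      ring
  | hs r =>
    rw [AlgHom.commutes, AlgHom.commutes, ← Algebra.smul_def, map_smul, LinearMap.smul_apply,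
      map_smul]
    rfl
  | hm y z hy hz => rw [map_mul (inr m n), mul_assoc, hy (hstable z hx), hz hx, map_mul, mul_assoc]
  | ha y z hy hz =>
    rw [map_add, map_add, add_mul, map_add, LinearMap.add_apply, map_add, hy hx, hz hx, add_mul]

end Invariants

/-! ## Tree vectors -/

/-- The first `k` cells. -/
def truncate (k : ℕ) (b : ℕ → ℕ × ℕ) : ℕ → ℕ × ℕ := fun i => if i < k then b i else 0

theorem truncate_succ (k : ℕ) (b : ℕ → ℕ × ℕ) :
    truncate (k + 1) b = Function.update (truncate k b) k (b k) := by
  funext i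
  by_cases h : i = k
  · rw [h, Function.update_self, truncate, if_pos (by omega)]
  · rw [Function.update_of_ne h]
    simp only [truncate]
    split_ifs <;> first | omega | rfl

theorem IsStd.truncate_self {k : ℕ} {b : ℕ → ℕ × ℕ} (hb : IsStd k b) : truncate k b = b := by
  funext i
  rw [truncate]
  split_ifs with h
  · rfl
  · exact (hb.zero i (by omega)).symm

theorem cells_shape_succ {lam mu : YoungDiagram} {n : ℕ} (P : StdTab lam mu n) (hle : lam ≤ mu) {i : ℕ}
    (hi : i < n) : (P.shape hle (i + 1)).cells = insert (P.fn i) (P.shape hle i).cells := by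
  ext c
  simp only [StdTab.shape, Finset.mem_insert, Finset.mem_union, Finset.mem_image,
    Finset.mem_filter, Finset.mem_univ, true_and, P.fn_of_lt hi]
  constructor
  · rintro (h | ⟨j, hj, rfl⟩)
    · exact Or.inr (Or.inl h)
    · rcases (show j.1 < i ∨ j.1 = i by omega) with h1 | h1
      · exact Or.inr (Or.inr ⟨j, h1, rfl⟩)
      · subst h1
        exact Or.inl rfl
  · rintro (rfl | h | ⟨j, hj, rfl⟩)
    · exact Or.inr ⟨⟨i, hi⟩, by simp, rfl⟩
    · exact Or.inl h
    · exact Or.inr ⟨j, by omega, rfl⟩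

theorem path_zero {m n : ℕ} {lam : Ptn m} {mu : Ptn (m + n)} (P : StdTab lam.1 mu.1 n)
    (hle : lam.1 ≤ mu.1) : P.path hle 0 (Nat.zero_le n) = lam := by
  refine Subtype.ext (YoungDiagram.ext ?_)
  ext c
  simp [StdTab.path, StdTab.shape]

theorem path_last {m n : ℕ} {lam : Ptn m} {mu : Ptn (m + n)} (P : StdTab lam.1 mu.1 n)
    (hle : lam.1 ≤ mu.1) : P.path hle n le_rfl = mu := by
  refine Subtype.ext (YoungDiagram.ext (Finset.eq_of_subset_of_card_le ?_ ?_))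
  · intro c hc
    simp only [StdTab.path, StdTab.shape, Finset.mem_union, Finset.mem_image] at hc
    rcases hc with h | ⟨j, -, rfl⟩
    · exact hle h
    · exact (Finset.mem_sdiff.1 (P.pos j).2).1
  · have h1 := (P.path hle n le_rfl).2
    have h2 := mu.2
    simp only [YoungDiagram.card] at h1 h2
    omega

/-- The vector of a vertex `ν_{i+1} → ν_i ⊗ □` is a multiple of a basis vector. -/
theorem vertex_vec {k : ℕ} {b c : ℕ → ℕ × ℕ} {d : ℕ × ℕ} {x : Hecke (k + 1)} (hb : IsStd (k + 1) b)
    (hc : IsStd k c) (hs : shape (k + 1) b = insert d (shape k c))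
    (hx : x ∈ Hom (prefixIdem (k + 1) (k + 1) b) (prefixIdem (k + 1) k c)) (h0 : x ≠ 0) :
    ∃ r : K, r ≠ 0 ∧
      rep (k + 1) x (vec (k + 1) b) = r • vec (k + 1) (Function.update c k d) := by
  classical
  -- A tableau in the support extends `c`, so only the cell `d` is left for its last box.
  have key : ∀ S, coord (k + 1) S (rep (k + 1) x (vec (k + 1) b)) ≠ 0 →
      S = Function.update c k d := by
    intro S hS
    obtain ⟨h1, h2, h3⟩ := coord_rep_vec (by omega) le_rfl hc hx.1 hS
    funext i
    by_cases hi : i = k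
    · subst hi
      rw [Function.update_self]
      have h4 : S i ∈ insert d (shape i c) := by
        rw [← hs, ← h2]
        exact mem_shape.2 ⟨i, by omega, rfl⟩
      refine (Finset.mem_insert.1 h4).resolve_right fun h5 => ?_
      obtain ⟨j, hj, e⟩ := mem_shape.1 h5
      have := h1.inj j i (by omega) (by omega) (by rw [h3 j hj, e])
      omega
    · rw [Function.update_of_ne hi]
      rcases lt_or_ge i k with h4 | h4
      · exact h3 i h4
      · rw [h1.zero i (by omega), hc.zero i h4]
  have hw : rep (k + 1) x (vec (k + 1) b) ≠ 0 := fun h => h0 (eq_zero_of_rep_vec hb hx.2 h)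
  have hex : ∃ S, IsStd (k + 1) S ∧ coord (k + 1) S (rep (k + 1) x (vec (k + 1) b)) ≠ 0 := by
    by_contra hne
    push Not at hne
    exact hw (eq_zero_of_coord hne)
  obtain ⟨S, hS, hS0⟩ := hex
  obtain rfl := key S hS0
  refine ⟨_, hS0, sub_eq_zero.1 (eq_zero_of_coord fun T hT => ?_)⟩
  rw [map_sub, map_smul, coord_vec hS, smul_eq_mul]
  split_ifs with h
  · rw [h, mul_one, sub_self]
  · rw [mul_zero, sub_zero]
    by_contra hne
    exact h (key T hne).symm

/-- Each vertex maps the chosen tableau of `ν_{i+1}` to a nonzero multiple of that of `ν_i` with the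
new box appended. The earlier part of the tree acts on the first `m + i` boxes only, so
`rep_inl_extend` carries the induction and the scalars multiply. -/
theorem treeVector_spec (t : Choice) {m n : ℕ} {lam : Ptn m} {mu : Ptn (m + n)}
    (hle : lam.1 ≤ mu.1) (P : StdTab lam.1 mu.1 n) (x : ∀ i : ℕ, Hecke (m + i + 1))
    (hx : IsVertices t hle P x) : ∀ (i : ℕ) (hi : i ≤ n),
      treeVector (simple t lam) x i ∈
        Hom (prefixIdem (m + i) (m + i) (t (m + i) (P.path hle i hi)).fn)
          (prefixIdem (m + i) m (t m lam).fn) ∧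
      ∃ r : K, r ≠ 0 ∧ rep (m + i) (treeVector (simple t lam) x i)
        (vec (m + i) (t (m + i) (P.path hle i hi)).fn) =
          r • vec (m + i) (truncate (m + i) (P.glue m (t m lam).fn)) := by
  have hc := (t m lam).isStd_fn
  intro i
  induction i with
  | zero =>
    intro hi
    have h0 : P.path hle 0 hi = lam := path_zero P hle
    have h1 : truncate (m + 0) (P.glue m (t m lam).fn) = (t m lam).fn := by
      funext i
      rw [truncate, StdTab.glue]
      split_ifs with h h' <;> first | omega | rfl | exact (hc.zero i (by omega)).symm
    rw [h0, h1, treeVector, simple, simpleIdem_eq]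
    have h2 := prefixIdem_mul_self (k := m) le_rfl le_rfl hc
    refine ⟨⟨h2, h2⟩, 1, one_ne_zero, ?_⟩
    rw [one_smul]
    exact (rep_prefixIdem_self hc hc).trans (if_pos rfl)
  | succ i ih =>
    intro hi
    obtain ⟨⟨h1, h2⟩, r, hr, h3⟩ := ih (by omega)
    obtain ⟨h4, h5⟩ := hx i hi
    have h6 := (t (m + i) (P.path hle i (Nat.le_of_succ_le hi))).isStd_fn
    have h7 : x i ∈ Hom (prefixIdem (m + i + 1) (m + i + 1)
        (t (m + (i + 1)) (P.path hle (i + 1) hi)).fn)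
        (prefixIdem (m + i + 1) (m + i) (t (m + i) (P.path hle i (Nat.le_of_succ_le hi))).fn) := by
      rw [simple, simple, tensor_simple_boxPow, simpleIdem_eq] at h4
      exact h4
    have h8 : shape (m + i + 1) (t (m + (i + 1)) (P.path hle (i + 1) hi)).fn =
        insert (P.fn i) (shape (m + i) (t (m + i) (P.path hle i (Nat.le_of_succ_le hi))).fn) := by
      rw [StdTab.shape_fn]
      exact (cells_shape_succ P hle (show i < n by omega)).trans
        (congrArg _ (StdTab.shape_fn _).symm)
    obtain ⟨s, hs, h9⟩ := vertex_vec (k := m + i)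
      (t (m + (i + 1)) (P.path hle (i + 1) hi)).isStd_fn h6 h8 h7 h5
    have e1 : treeVector (simple t lam) x (i + 1) =
        inl (m + i) 1 (treeVector (simple t lam) x i) * x i := by
      rw [treeVector, tensor_boxPow_eq]
    have e2 : truncate (m + (i + 1)) (P.glue m (t m lam).fn) =
        Function.update (truncate (m + i) (P.glue m (t m lam).fn)) (m + i) (P.fn i) := by
      rw [← P.glue_add m (t m lam).fn i]
      exact truncate_succ _ _
    have h10 : ∀ j, m + i ≤ j → truncate (m + i) (P.glue m (t m lam).fn) j = 0 :=
      fun j hj => if_neg (by omega)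
    rw [e1, e2]
    refine ⟨⟨?_, ?_⟩, s * r, mul_ne_zero hs hr, ?_⟩
    · change prefixIdem (m + i + 1) m _ * _ = _
      rw [← inl_prefixIdem (m := m + i) (n := 1) (by omega), ← mul_assoc, ← map_mul, h1]
    · rw [mul_assoc]
      exact congrArg _ h7.2
    · change rep (m + i + 1) _ (vec (m + i + 1) _) = _ • vec (m + i + 1) _
      rw [map_mul, Module.End.mul_apply, h9, map_smul, ← extend_vec h6.zero, rep_inl_extend, h3,
        map_smul, extend_vec h10, smul_smul]

/-! ## The main theorem -/

theorem mem_invariants {t : Choice} {m n : ℕ} {lam : Ptn m} {mu : Ptn (m + n)}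
    {x : SkewRep t lam mu} :
    x ∈ invariants t lam mu ↔ ∀ h, inr m n h * x.1 = triv n h • x.1 :=
  forall_congr' fun _ => Subtype.ext_iff

/-- A column with two boxes of the skew shape contains two vertical neighbours; a column reading
gives them consecutive entries, and `eq_zero_of_column` applies. -/
theorem invariants_eq_bot (t : Choice) {m n : ℕ} (lam : Ptn m) (mu : Ptn (m + n))
    (hle : lam.1 ≤ mu.1) (h : ¬ HorizontalStrip lam.1 mu.1) : invariants t lam mu = ⊥ := by
  have hbad : ∃ i j, (i, j) ∈ mu.1.cells \ lam.1.cells ∧ (i + 1, j) ∈ mu.1.cells \ lam.1.cells := by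
    have h1 : ∃ c ∈ mu.1.cells \ lam.1.cells, ∃ d ∈ mu.1.cells \ lam.1.cells,
        c.2 = d.2 ∧ c.1 < d.1 := by
      have h2 : ¬ ∀ c ∈ mu.1.cells \ lam.1.cells, ∀ d ∈ mu.1.cells \ lam.1.cells,
        c.2 = d.2 → c = d := fun h3 => h ⟨hle, h3⟩
      push Not at h2
      obtain ⟨c, hc, d, hd, h3, h4⟩ := h2
      rcases lt_trichotomy c.1 d.1 with h5 | h5 | h5
      · exact ⟨c, hc, d, hd, h3, h5⟩
      · exact absurd (Prod.ext h5 h3) h4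
      · exact ⟨d, hd, c, hc, h3.symm, h5⟩
    obtain ⟨c, hc, d, hd, h2, h3⟩ := h1
    -- The cell just below the upper box `c` lies in `μ` because it is above or equal to `d`, and
    -- outside `λ` because `c` is.
    refine ⟨c.1, c.2, hc, Finset.mem_sdiff.2 ⟨?_, fun h4 => ?_⟩⟩
    · exact mu.1.isLowerSet (show ((c.1 + 1, c.2) : ℕ × ℕ) ≤ d from ⟨h3, h2.le⟩)
        (Finset.mem_sdiff.1 hd).1
    · exact (Finset.mem_sdiff.1 hc).2
        (lam.1.isLowerSet (show c ≤ (c.1 + 1, c.2) from ⟨by simp, le_rfl⟩) h4)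
  obtain ⟨i, j, h1, h2⟩ := hbad
  obtain ⟨P, l, hl, e1, e2⟩ := StdTab.exists_column_reading (card_skew lam mu hle) h1 h2
  have hcs := (t m lam).shape_fn
  rw [eq_bot_iff]
  intro x hx
  have hx' := mem_invariants.1 hx
  have hx'' := (skewRep_eq t lam mu).le x.2
  refine (Submodule.mem_bot K).2 (Subtype.ext ?_)
  refine eq_zero_of_column (t _ mu).isStd_fn (t m lam).isStd_fn hx'' hx'
    (P.isStd_glue (t m lam).isStd_fn hcs)
    ((P.shape_glue hle hcs).trans (t _ mu).shape_fn.symm) (fun i hi => P.glue_of_lt _ hi) hl ?_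
  rw [P.glue_add, add_assoc, P.glue_add, e1, e2]
  simp only [cont]
  push_cast
  ring

end
end SkewHecke

open SkewHecke

theorem mainTheorem2 (t : Choice) (m n : ℕ) (lam : Ptn m) (mu : Ptn (m + n))
    (hle : lam.1 ≤ mu.1) :
    (invariants t lam mu ≠ ⊥ ↔ HorizontalStrip lam.1 mu.1) ∧
    (HorizontalStrip lam.1 mu.1 →
      Module.finrank K (invariants t lam mu) = 1 ∧
      (∃! π : Module.End K (SkewRep t lam mu), IsInvariantProjection t lam mu π) ∧
      ∀ (P : StdTab lam.1 mu.1 n) (x : ∀ i : ℕ, Hecke (m + i + 1)), IsVertices t hle P x →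
        ∃ hv : treeVector (simple t lam) x n ∈ SkewRep t lam mu,
          ∀ π : Module.End K (SkewRep t lam mu), IsInvariantProjection t lam mu π →
            π ⟨treeVector (simple t lam) x n, hv⟩ ≠ 0) := by
  have hb := (t _ mu).isStd_fn
  have hbs := (t _ mu).shape_fn
  have hc := (t m lam).isStd_fn
  have hcs := (t m lam).shape_fn
  have hmem : ∀ x : SkewRep t lam mu, x.1 ∈ Hom (prefixIdem (m + n) (m + n) (t _ mu).fn)
      (prefixIdem (m + n) m (t m lam).fn) := fun x => skewRep_eq t lam mu ▸ x.2
  obtain ⟨p, hp1, hp2, hp3⟩ := exists_symmetrizer n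
  have hpinv : ∀ x : SkewRep t lam mu, action t lam mu p x ∈ invariants t lam mu := by
    intro x h
    rw [← Module.End.mul_apply, ← map_mul, hp2, map_smul, LinearMap.smul_apply]
  have hpid : ∀ x ∈ invariants t lam mu, action t lam mu p x = x := by
    intro x hx
    rw [hx p, hp1, one_smul]
  -- The coordinate sum, which `p` preserves for a horizontal strip since `triv n p = 1`.
  let E : SkewRep t lam mu → K := fun x =>
    coordSum (m + n) (rep (m + n) x.1 (vec (m + n) (t _ mu).fn))
  have hE0 : E 0 = 0 := by simp [E]
  have hE : HorizontalStrip lam.1 mu.1 → ∀ x, E (action t lam mu p x) = E x := by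
    intro hst x
    have := coordSum_inr hst hbs hc hcs p (hmem x)
    rw [hp1, one_mul] at this
    exact this
  -- An arbitrary reference tableau with two uses: its basis vector has `E = 1`, so `p` maps it to a
  -- nonzero invariant, and its coordinate separates invariants.
  obtain ⟨P₀⟩ := StdTab.exists_of_card (card_skew lam mu hle)
  have hS := P₀.isStd_glue hc hcs
  have hSs := (P₀.shape_glue hle hcs).trans hbs.symm
  have hSc : ∀ i < m, P₀.glue m (t m lam).fn i = (t m lam).fn i := fun i hi => P₀.glue_of_lt _ hi
  obtain ⟨x₀, hx₀, hv₀⟩ := exists_hom_vec (by omega) le_rfl hb hc hS hSs hSc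
  rw [← skewRep_eq] at hx₀
  have hEx₀ : E ⟨x₀, hx₀⟩ = 1 := by
    simp only [E]
    rw [hv₀, coordSum_vec hS]
  have hne : HorizontalStrip lam.1 mu.1 → action t lam mu p ⟨x₀, hx₀⟩ ≠ 0 := by
    intro hst h0
    have := hE hst ⟨x₀, hx₀⟩
    rw [h0, hE0, hEx₀] at this
    exact zero_ne_one this
  refine ⟨⟨fun h => ?_, fun hst h => ?_⟩, fun hst => ⟨?_, ?_, ?_⟩⟩
  · by_contra hst
    exact h (invariants_eq_bot t lam mu hle hst)
  · have := hpinv ⟨x₀, hx₀⟩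
    rw [h] at this
    exact hne hst ((Submodule.mem_bot K).1 this)
  · let C : SkewRep t lam mu →ₗ[K] K := (coord (m + n) (P₀.glue m (t m lam).fn)).comp
      ((LinearMap.applyₗ (vec (m + n) (t _ mu).fn)).comp
        ((rep (m + n)).toLinearMap.comp (SkewRep t lam mu).subtype))
    have hC : ∀ x ∈ invariants t lam mu, C x = 0 → x = 0 := fun x hx h0 =>
      Subtype.ext (eq_zero_of_invariant hb hc (hmem x) (mem_invariants.1 hx) hS hSs hSc h0)
    let v : invariants t lam mu := ⟨_, hpinv ⟨x₀, hx₀⟩⟩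
    have hCv : C v.1 ≠ 0 := fun h => hne hst (hC v.1 v.2 h)
    -- The reference coordinate identifies the invariants with the ground field.
    have hbij : Function.Bijective (C.comp (invariants t lam mu).subtype) := by
      constructor
      · intro x y hxy
        have h1 := hC _ ((invariants t lam mu).add_mem x.2 ((invariants t lam mu).smul_mem (-1) y.2))
          (by
            change C x.1 = C y.1 at hxy
            rw [map_add, map_smul, hxy, neg_one_smul, add_neg_cancel])
        have h2 : (-1 : K) • y.1.1 = -y.1.1 := neg_one_smul K y.1.1
        have h3 : x.1.1 + (-1 : K) • y.1.1 = 0 := congrArg Subtype.val h1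
        rw [h2, ← sub_eq_add_neg] at h3
        exact Subtype.ext (Subtype.ext (sub_eq_zero.1 h3))
      · intro r
        refine ⟨(r / C v.1) • v, ?_⟩
        rw [map_smul]
        exact div_mul_cancel₀ r hCv
    rw [(LinearEquiv.ofBijective _ hbij).finrank_eq, Module.finrank_self]
  · refine ⟨action t lam mu p, ⟨⟨hpinv, hpid⟩, fun h x => ?_⟩, fun π hπ => ?_⟩
    · rw [← Module.End.mul_apply, ← Module.End.mul_apply, ← map_mul, ← map_mul, hp2, hp3]
    · refine LinearMap.ext fun x => ?_
      -- `π x = p (π x) = π (p x) = p x`, because both `p` and `π` fix the invariants.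
      rw [← hpid (π x) (hπ.1.map_mem x), ← hπ.2, hπ.1.map_id _ (hpinv x)]
  · intro P x hx
    obtain ⟨h1, r, hr, h2⟩ := treeVector_spec t hle P x hx n le_rfl
    rw [path_last P hle] at h1 h2
    have hv : treeVector (simple t lam) x n ∈ SkewRep t lam mu := by
      rw [skewRep_eq]
      exact h1
    refine ⟨hv, fun π hπ h0 => hr ?_⟩
    have h3 : π ⟨_, hv⟩ = action t lam mu p ⟨_, hv⟩ := by
      rw [← hpid (π _) (hπ.1.map_mem _), ← hπ.2, hπ.1.map_id _ (hpinv _)]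
    -- If the projection vanished, so would the coordinate sum of the tree vector, but that sum is
    -- the nonzero scalar `r`.
    have h4 := hE hst ⟨_, hv⟩
    rw [← h3, h0, hE0] at h4
    simp only [E] at h4
    have hP := P.isStd_glue hc hcs
    rw [h2, hP.truncate_self, map_smul, coordSum_vec hP, smul_eq_mul, mul_one] at h4
    exact h4.symm
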